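/- Let $1\le k\le m$ be integers and $\gamma>0$. For $t\in\mathbb{R}^m$ let $\|t\|_0$ be the number of nonzero entries of $t$, let $\mathcal{B}_k=\{t\in\mathbb{R}^m:\|t\|_0\le k\}$, and put $$\Omega(t)=\tfrac{\gamma}{2}\|t\|_2^2+\delta_{\mathcal{B}_k}(t),\qquad \Psi(t)=\tfrac12\inf\Big\{\sum_{i=1}^m \frac{t_i^2}{\lambda_i}:\ \lambda\in\mathbb{R}^m,\ \sum_{i=1}^m\lambda_i=k,\ 0<\lambda_i\le 1\ \ \forall i\Big\},$$ where $\delta_S$ is $0$ on $S$ and $+\infty$ off $S$; $\Psi$ is the squared $k$-support norm. For $f:\mathbb{R}^m\to\mathbb{R}\cup\{\pm\infty\}$ let $f^*(s)=\sup_{t}\,\langle s,t\rangle-f(t)$ be its conjugate. For $b\ge 0$ let $b\triangle^m=\{t\in\mathbb{R}^m_+:\sum_i t_i=b\}$, and write $\triangle^m=1\triangle^m$. Let $\Omega_+=\Omega+\delta_{\mathbb{R}^m_+}$, $\Omega_b=\Omega+\delta_{b\triangle^m}$, and write $\Omega_+^*,\Omega_+^{**},\Omega_b^*,\Omega_b^{**}$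 for their conjugates and biconjugates. **(1)** $\Omega_+^{**}(t)=\gamma\Psi(t)$ if $t\in\mathbb{R}^m_+$, and $\Omega_+^{**}(t)=+\infty$ otherwise. **(2)** For every $b\ge 0$: $\Omega_b^{**}(t)=\gamma\Psi(t)$ if $t\in b\triangle^m$, and $\Omega_b^{**}(t)=+\infty$ otherwise. **(3)** For $a\in\triangle^m$, $b\in\triangle^n$ and a matrix $C\in\mathbb{R}_+^{m\times n}$ with columns $c_1,\dots,c_n$, let $\mathcal{U}(a,b)=\{T\in\mathbb{R}^{m\times n}_+:T\mathbf 1_n=a,\ T^\top\mathbf 1_m=b\}$, and, for a regularizer $R:\mathbb{R}^m\to\mathbb{R}_+\cup\{\infty\}$, $$P_R(a,b,C)=\min_{T\in\mathcal{U}(a,b)}\langle T,C\rangle+\sum_{j=1}^n R(t_j),$$ where $t_j$ is the $j$-th column of $T$, and $$D_\Omega(a,b,C)=\max_{\alpha\in\mathbb{R}^m,\,\beta\in\mathbb{R}^n}\langle\alpha,a\rangle+\langle\beta,b\rangle-\sum_{j=1}^n\Omega_+^*(\alpha+\beta_j\mathbf 1_m-c_j),$$ $$S_\Omega(a,b,C)=\max_{\alpha\in\mathbb{R}^m}\langle\alpha,a\rangle-\sum_{j=1}^n\Omega_{b_j}^*(\alpha-c_j).$$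 The sum in $S_\Omega$ is, as a function of $\alpha$, the conjugate of $a'\mapsto P_\Omega(a',b,C)$ (which is $+\infty$ if $\mathcal{U}(a',b)=\varnothing$). The maxima in $D_\Omega$ and $S_\Omega$ and the minima in $P_{\gamma\Psi}$ and $P_\Omega$ are attained (the value of $P_\Omega$ being $+\infty$ if no $T\in\mathcal{U}(a,b)$ has all its columns in $\mathcal{B}_k$), and $$D_\Omega(a,b,C)=S_\Omega(a,b,C)=P_{\gamma\Psi}(a,b,C)\le P_\Omega(a,b,C).$$ **(4)** Say that $s\in\mathbb{R}^m$ has no ties if the set of indices of its $k$ largest entries is unique (for instance if the entries of $s$ are pairwise distinct). The last inequality in (3) is an equality if there is an optimal solution $(\alpha^\star,\beta^\star)$ of the maximization that defines $D_\Omega$ such that $\alpha^\star+\beta^\star_j\mathbf 1_m-c_j$ has no ties for every $j$, or an optimal solution $\alpha^\star$ of the one that defines $S_\Omega$ such that $\alpha^\star-c_j$ has no ties for every $j$. For $\gamma=1$ the function $\gamma\Psi$ is $\Psi$. -/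

import Mathlib

namespace SparseOT

noncomputable section

/-- The indicator function `δ_S` of convex analysis: `0` on `S` and `+∞` off `S`. -/
def indicator {E : Type*} (S : Set E) (t : E) : EReal :=
  open Classical in if t ∈ S then 0 else ⊤

/-- The convex conjugate `f^*(s) = sup_t ⟨s, t⟩ - f(t)`. Points with `f t = +∞` contribute `-∞`,
so that the supremum is the one over the domain of `f`. -/
def conj {m : ℕ} (f : (Fin m → ℝ) → EReal) (s : Fin m → ℝ) : EReal :=
  ⨆ t : Fin m → ℝ, ((s ⬝ᵥ t : ℝ) : EReal) - f t

/-- The nonnegative orthant of `ℝ^m`. -/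
def orthant (m : ℕ) : Set (Fin m → ℝ) := {t | ∀ i, 0 ≤ t i}

/-- The scaled simplex: nonnegative vectors whose entries sum to `b`. -/
def scaledSimplex (m : ℕ) (b : ℝ) : Set (Fin m → ℝ) :=
  {t | (∀ i, 0 ≤ t i) ∧ ∑ i, t i = b}

/-- The level set of the `ℓ₀` pseudo norm: vectors with at most `k` nonzero entries. -/
def sparseSet (m k : ℕ) : Set (Fin m → ℝ) := {t | hammingNorm t ≤ k}

/-- The nonconvex regularizer `Ω = (γ/2) ‖·‖₂² + δ_{B_k}`. -/
def sparseReg (m k : ℕ) (γ : ℝ) (t : Fin m → ℝ) : EReal :=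
  ((γ / 2 * ∑ i, t i ^ 2 : ℝ) : EReal) + indicator (sparseSet m k) t

/-- `Ω + δ` for the nonnegative orthant. -/
def restrictOrthant {m : ℕ} (Ω : (Fin m → ℝ) → EReal) (t : Fin m → ℝ) : EReal :=
  Ω t + indicator (orthant m) t

/-- `Ω + δ` for the scaled simplex. -/
def restrictSimplex {m : ℕ} (Ω : (Fin m → ℝ) → EReal) (b : ℝ) (t : Fin m → ℝ) : EReal :=
  Ω t + indicator (scaledSimplex m b) t

/-- The squared `k`-support norm
`Ψ(t) = (1/2) inf {∑ i, t_i² / λ_i | ∑ i, λ_i = k, 0 < λ_i ≤ 1}`. -/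
def sqKSupport (m k : ℕ) (t : Fin m → ℝ) : EReal :=
  ⨅ l ∈ {l : Fin m → ℝ | ∑ i, l i = (k : ℝ) ∧ ∀ i, 0 < l i ∧ l i ≤ 1},
    ((1 / 2 * ∑ i, t i ^ 2 / l i : ℝ) : EReal)

/-- The transportation polytope. -/
def transportPolytope {m n : ℕ} (a : Fin m → ℝ) (b : Fin n → ℝ) :
    Set (Matrix (Fin m) (Fin n) ℝ) :=
  {T | (∀ i j, 0 ≤ T i j) ∧ (∀ i, ∑ j, T i j = a i) ∧ ∀ j, ∑ i, T i j = b j}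

/-- The objective `⟨T, C⟩ + ∑ j, Ω(t_j)`, where `t_j` is the `j`-th column of `T`. -/
def primalObj {m n : ℕ} (Ω : (Fin m → ℝ) → EReal) (C T : Matrix (Fin m) (Fin n) ℝ) : EReal :=
  ((∑ i, ∑ j, T i j * C i j : ℝ) : EReal) + ∑ j, Ω (fun i => T i j)

/-- The primal value `P_Ω(a, b, C)`. -/
def primal {m n : ℕ} (Ω : (Fin m → ℝ) → EReal) (a : Fin m → ℝ) (b : Fin n → ℝ)
    (C : Matrix (Fin m) (Fin n) ℝ) : EReal :=
  ⨅ T ∈ transportPolytope a b, primalObj Ω C T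

/-- The objective of the dual problem. -/
def dualObj {m n : ℕ} (Ω : (Fin m → ℝ) → EReal) (a : Fin m → ℝ) (b : Fin n → ℝ)
    (C : Matrix (Fin m) (Fin n) ℝ) (α : Fin m → ℝ) (β : Fin n → ℝ) : EReal :=
  ((α ⬝ᵥ a + β ⬝ᵥ b : ℝ) : EReal)
    - ∑ j, conj (restrictOrthant Ω) (fun i => α i + β j - C i j)

/-- The dual value `D_Ω(a, b, C)`. -/
def dual {m n : ℕ} (Ω : (Fin m → ℝ) → EReal) (a : Fin m → ℝ) (b : Fin n → ℝ)
    (C : Matrix (Fin m) (Fin n) ℝ) : EReal :=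
  ⨆ (α : Fin m → ℝ) (β : Fin n → ℝ), dualObj Ω a b C α β

/-- The objective of the semi-dual problem. -/
def semiDualObj {m n : ℕ} (Ω : (Fin m → ℝ) → EReal) (a : Fin m → ℝ) (b : Fin n → ℝ)
    (C : Matrix (Fin m) (Fin n) ℝ) (α : Fin m → ℝ) : EReal :=
  ((α ⬝ᵥ a : ℝ) : EReal)
    - ∑ j, conj (restrictSimplex Ω (b j)) (fun i => α i - C i j)

/-- The semi-dual value `S_Ω(a, b, C)`. -/
def semiDual {m n : ℕ} (Ω : (Fin m → ℝ) → EReal) (a : Fin m → ℝ) (b : Fin n → ℝ)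
    (C : Matrix (Fin m) (Fin n) ℝ) : EReal :=
  ⨆ α : Fin m → ℝ, semiDualObj Ω a b C α

/-- `I` is a set of `k` indices that carry the `k` largest entries of `s`. -/
def IsTopK {m : ℕ} (k : ℕ) (s : Fin m → ℝ) (I : Finset (Fin m)) : Prop :=
  I.card = k ∧ ∀ i ∈ I, ∀ i' ∉ I, s i' ≤ s i

/-- There is no tie in `s` in the selection of its `k` largest entries: there is only one possible
top-`k` vector. By `noTies_of_injective`, this holds if the entries of `s` are distinct. -/
def NoTies {m : ℕ} (k : ℕ) (s : Fin m → ℝ) : Prop :=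
  ∀ I J : Finset (Fin m), IsTopK k s I → IsTopK k s J → I = J

theorem noTies_of_injective {m : ℕ} (k : ℕ) (s : Fin m → ℝ) (hs : Function.Injective s) :
    NoTies k s := by
  intro I J hI hJ
  by_contra hne
  have hIJ : ¬ I ⊆ J := fun h => hne (Finset.eq_of_subset_of_card_le h (by rw [hI.1, hJ.1]))
  have hJI : ¬ J ⊆ I := fun h => hne (Finset.eq_of_subset_of_card_le h (by rw [hI.1, hJ.1])).symm
  obtain ⟨x, hxI, hxJ⟩ := Finset.not_subset.mp hIJ
  obtain ⟨y, hyJ, hyI⟩ := Finset.not_subset.mp hJI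
  have hxy : x = y := hs (le_antisymm (hJ.2 y hyJ x hxJ) (hI.2 x hxI y hyI))
  exact hxJ (hxy ▸ hyJ)

end

end SparseOT

namespace SparseOT

/-! ### Extended real sums -/

/-! Everything reduces to real-valued functions. Ω_+^* at s is the sum of max(s_i, 0)² / (2γ) over a
top-k set (`orthantConj_eq`). Ω_b^*(s) is the minimum over τ of Ω_+^*(s + τ𝟏) - τb, where τ is the
multiplier of the mass constraint (`simplexConj_le`, `exists_simplexConj_eq`).

Two facts give the biconjugates. Young's inequality in each entry, weighted by λ, yields
Fenchel-Young: ⟨s, t⟩ ≤ Ω_+^*(s) + γΨ(t) for t ≥ 0 (`dotProduct_le_orthantConj_add`). Conversely Ψ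
is finite and convex, so γΨ has a subgradient g at t. Since γΨ ≤ Ω on k-sparse vectors, both
conjugates at g are at most ⟨g, t⟩ - γΨ(t). Hence the supremum defining the biconjugate is γΨ(t),
attained at g. Outside the orthant or simplex, a violated linear constraint gives a ray along which
the supremum is infinite.

Weak duality is Fenchel-Young summed over columns. For equality and dual attainment, take a
minimizer T of the relaxed primal, which exists by compactness. A subgradient g at T can be chosen
that is itself minimized at T over the polytope. Farkas' lemma then gives potentials with α_i + β_j
≤ g_ij and g(T) = ⟨α, a⟩ + ⟨β, b⟩, and monotonicity of Ω_+^* closes the gap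
(`exists_relaxedObj_le_dualVal`). A zero gap forces equality in Fenchel-Young for every column of T.
Without ties this makes the columns k-sparse, and there Ω = γΨ. -/

theorem ereal_coe_sum {ι : Type*} (s : Finset ι) (f : ι → ℝ) :
    ((∑ i ∈ s, f i : ℝ) : EReal) = ∑ i ∈ s, (f i : EReal) := by
  classical
  induction s using Finset.induction_on with
  | empty => simp
  | insert a s ha ih => rw [Finset.sum_insert ha, Finset.sum_insert ha, EReal.coe_add, ih]

theorem ereal_sum_eq_top {ι : Type*} (s : Finset ι) (f : ι → EReal)
    (hbot : ∀ i ∈ s, f i ≠ ⊥) (htop : ∃ i ∈ s, f i = ⊤) : ∑ i ∈ s, f i = ⊤ := by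
  classical
  obtain ⟨i, hi, hfi⟩ := htop
  rw [← Finset.add_sum_erase s f hi, hfi]
  refine EReal.top_add_of_ne_bot fun h => ?_
  obtain ⟨j, hj, hfj⟩ := WithBot.sum_eq_bot_iff.1 h
  exact hbot j (Finset.mem_of_mem_erase hj) hfj

/-! ### Conjugates -/

theorem le_conj {m : ℕ} (f : (Fin m → ℝ) → EReal) (s t : Fin m → ℝ) :
    ((s ⬝ᵥ t : ℝ) : EReal) - f t ≤ conj f s :=
  le_iSup (fun t => ((s ⬝ᵥ t : ℝ) : EReal) - f t) t

/-- To bound the conjugate of a function that is finite on `S` and `+∞` off `S`, only the points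
of `S` matter. -/
theorem conj_le_coe {m : ℕ} {f : (Fin m → ℝ) → EReal} {q : (Fin m → ℝ) → ℝ}
    {S : Set (Fin m → ℝ)} (hS : ∀ t ∈ S, f t = (q t : EReal)) (hS' : ∀ t ∉ S, f t = ⊤)
    {s : Fin m → ℝ} {c : ℝ} (h : ∀ t ∈ S, s ⬝ᵥ t - q t ≤ c) : conj f s ≤ (c : EReal) := by
  refine iSup_le fun t => ?_
  by_cases ht : t ∈ S
  · rw [hS t ht, ← EReal.coe_sub]
    exact EReal.coe_le_coe_iff.2 (h t ht)
  · rw [hS' t ht, EReal.sub_top]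
    exact bot_le

theorem conj_eq_coe {m : ℕ} {f : (Fin m → ℝ) → EReal} {q : (Fin m → ℝ) → ℝ}
    {S : Set (Fin m → ℝ)} (hS : ∀ t ∈ S, f t = (q t : EReal)) (hS' : ∀ t ∉ S, f t = ⊤)
    {s : Fin m → ℝ} {c : ℝ} (h : ∀ t ∈ S, s ⬝ᵥ t - q t ≤ c)
    (h' : ∃ t ∈ S, s ⬝ᵥ t - q t = c) : conj f s = (c : EReal) := by
  refine le_antisymm (conj_le_coe hS hS' h) ?_
  obtain ⟨t, ht, htc⟩ := h'
  rw [← htc, EReal.coe_sub, ← hS t ht]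
  exact le_conj f s t

/-- A conjugate is `+∞` at `t` if `f` grows slower than `⟨t, ·⟩` along the ray spanned by `d`. -/
theorem conj_eq_top_of_ray {m : ℕ} {f : (Fin m → ℝ) → EReal} {t d : Fin m → ℝ} {r : ℝ}
    (hf : ∀ N : ℝ, 0 ≤ N → f (N • d) ≤ ((N * r : ℝ) : EReal)) (hr : r < d ⬝ᵥ t) :
    conj f t = ⊤ := by
  rw [EReal.eq_top_iff_forall_lt]
  intro y
  have hpos : 0 < d ⬝ᵥ t - r := sub_pos.2 hr
  -- This length makes the gain N(⟨d, t⟩ - r) equal to |y| + 1, which exceeds y.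
  set N : ℝ := (|y| + 1) / (d ⬝ᵥ t - r) with hN
  have hN0 : 0 ≤ N := by positivity
  have hval : N * (d ⬝ᵥ t) - N * r = |y| + 1 := by
    rw [← mul_sub, hN]; field_simp
  calc (y : EReal) < ((N * (d ⬝ᵥ t) - N * r : ℝ) : EReal) := by
        rw [hval]; exact EReal.coe_lt_coe_iff.2 (by linarith [le_abs_self y])
    _ = ((t ⬝ᵥ N • d : ℝ) : EReal) - ((N * r : ℝ) : EReal) := by
        rw [← EReal.coe_sub, dotProduct_smul, smul_eq_mul, dotProduct_comm t d]
    _ ≤ ((t ⬝ᵥ N • d : ℝ) : EReal) - f (N • d) := EReal.sub_le_sub le_rfl (hf N hN0)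
    _ ≤ conj f t := le_conj f t _

/-! ### Subgradients and Farkas' lemma -/

/-- At a minimizer over a convex set, a continuous convex function has a subgradient that is
itself minimized there. -/
theorem exists_subgradient_isMinOn {E : Type*} [TopologicalSpace E] [AddCommGroup E] [Module ℝ E]
    [IsTopologicalAddGroup E] [ContinuousSMul ℝ E] {F : E → ℝ} (hF : ConvexOn ℝ Set.univ F)
    (hFc : Continuous F) {U : Set E} (hU : Convex ℝ U) {x : E} (hx : x ∈ U)
    (hmin : ∀ y ∈ U, F x ≤ F y) :
    ∃ g : E →ₗ[ℝ] ℝ, (∀ y, F x + (g y - g x) ≤ F y) ∧ ∀ y ∈ U, g x ≤ g y := by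
  have hA : Convex ℝ {p : E × ℝ | p.1 ∈ Set.univ ∧ F p.1 < p.2} := hF.convex_strict_epigraph
  have hAo : IsOpen {p : E × ℝ | p.1 ∈ Set.univ ∧ F p.1 < p.2} := by
    simp only [Set.mem_univ, true_and]
    exact isOpen_lt (hFc.comp continuous_fst) continuous_snd
  have hB : Convex ℝ (U ×ˢ {F x} : Set (E × ℝ)) := hU.prod (convex_singleton _)
  -- Minimality of x makes the open strict epigraph disjoint from U × {F x}; one separating
  -- hyperplane gives both conclusions.
  obtain ⟨f, u, hfA, hfB⟩ := geometric_hahn_banach_open hA hAo hB (by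
    rw [Set.disjoint_left]
    rintro ⟨y, r⟩ ⟨-, hyr⟩ ⟨hy, hr⟩
    simp only [Set.mem_singleton_iff] at hy hr hyr
    exact absurd (hmin y hy) (by rw [← hr]; exact not_le.2 hyr))
  set c : ℝ := f (0, 1) with hc
  have hsplit : ∀ y r, f (y, r) = f (y, 0) + r * c := by
    intro y r
    rw [hc, ← smul_eq_mul, ← map_smul, ← map_add]
    simp
  have hxu : u ≤ f (x, 0) + F x * c := by
    rw [← hsplit]; exact hfB _ ⟨hx, rfl⟩
  have hstrict : ∀ y r, F y < r → f (y, 0) + r * c < u := by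
    intro y r h
    rw [← hsplit]; exact hfA _ ⟨trivial, h⟩
  have hc0 : c < 0 := by
    have := hstrict x (F x + 1) (by linarith)
    linarith
  have hcne : c ≠ 0 := hc0.ne
  -- The strict bound passes to the graph: otherwise the height r chosen below lies above F y, yet
  -- the functional equals u there.
  have hle : ∀ y, f (y, 0) + F y * c ≤ u := by
    intro y
    by_contra! h
    have := hstrict y (F y + (f (y, 0) + F y * c - u) / (-c))
      (by have : 0 < (f (y, 0) + F y * c - u) / (-c) := div_pos (by linarith) (by linarith)
          linarith)
    have h2 : (f (y, 0) + F y * c - u) / (-c) * c = -(f (y, 0) + F y * c - u) := by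
      field_simp
    rw [add_mul, h2] at this
    linarith
  let g : E →ₗ[ℝ] ℝ := (-c)⁻¹ • ((f : E × ℝ →ₗ[ℝ] ℝ) ∘ₗ LinearMap.inl ℝ E ℝ)
  have hg : ∀ y, f (y, 0) = g y * (-c) := by
    intro y
    simp only [g, LinearMap.smul_apply, LinearMap.comp_apply, LinearMap.inl_apply, smul_eq_mul,
      ContinuousLinearMap.coe_coe]
    field_simp
  refine ⟨g, fun y => ?_, fun y hy => ?_⟩
  · have h1 := hle y
    rw [hg] at h1 hxu
    nlinarith
  · have h1 := hfB (y, F x) ⟨hy, rfl⟩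
    have h2 := hle x
    rw [hsplit, hg] at h1
    rw [hg] at h2
    nlinarith

/-- **Farkas' lemma** for finitely many linear functionals. -/
theorem farkas {ι V : Type*} [AddCommGroup V] [Module ℝ V] (s : Finset ι) (f : ι → V →ₗ[ℝ] ℝ)
    (g : V →ₗ[ℝ] ℝ) (h : ∀ x, (∀ i ∈ s, 0 ≤ f i x) → 0 ≤ g x) :
    ∃ c : ι → ℝ, (∀ i, 0 ≤ c i) ∧ g = ∑ i ∈ s, c i • f i := by
  classical
  induction s using Finset.induction_on generalizing f g with
  | empty =>
    refine ⟨0, fun _ => le_rfl, ?_⟩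
    ext x
    have h1 := h x (by simp)
    have h2 := h (-x) (by simp)
    rw [map_neg] at h2
    simp only [Finset.sum_empty, LinearMap.zero_apply]
    linarith
  | insert a s ha ih =>
    -- If the constraint a is redundant, its coefficient is 0. Otherwise a witness y has g y < 0 and
    -- hence f a y < 0. Subtracting multiples of f a makes all functionals vanish at y, and
    -- projecting along y onto the kernel of f a reduces to the smaller family.
    by_cases hs : ∀ x, (∀ i ∈ s, 0 ≤ f i x) → 0 ≤ g x
    · obtain ⟨c, hc, hg⟩ := ih f g hs
      refine ⟨Function.update c a 0, fun i => ?_, ?_⟩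
      · by_cases hi : i = a
        · subst hi; simp
        · simpa [hi] using hc i
      · rw [Finset.sum_insert ha, hg]
        simp only [Function.update_self, zero_smul, zero_add]
        exact Finset.sum_congr rfl fun i hi => by
          rw [Function.update_of_ne (ne_of_mem_of_not_mem hi ha)]
    · push Not at hs
      obtain ⟨y, hy, hgy⟩ := hs
      have hay : f a y < 0 := by
        by_contra! hcon
        have := h y (by
          intro i hi
          rcases Finset.mem_insert.1 hi with rfl | hi
          exacts [hcon, hy i hi])
        linarith
      have hay' : f a y ≠ 0 := hay.ne
      obtain ⟨c, hc, hg⟩ := ih (fun i => f i - (f i y / f a y) • f a) (g - (g y / f a y) • f a) (by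
        intro x hx
        have := h (x - (f a x / f a y) • y) (by
          intro i hi
          rcases Finset.mem_insert.1 hi with rfl | hi
          · simp [hay']
          · have := hx i hi
            simp only [LinearMap.sub_apply, LinearMap.smul_apply, smul_eq_mul, map_sub,
              map_smul] at this ⊢
            calc _ ≤ _ := this
              _ = _ := by ring)
        simp only [LinearMap.sub_apply, LinearMap.smul_apply, smul_eq_mul, map_sub,
          map_smul] at this ⊢
        calc _ ≤ _ := this
          _ = _ := by ring)
      refine ⟨Function.update c a (g y / f a y - ∑ i ∈ s, c i * (f i y / f a y)), fun i => ?_, ?_⟩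
      · by_cases hi : i = a
        · subst hi
          rw [Function.update_self]
          have h1 : 0 ≤ g y / f i y := div_nonneg_of_nonpos hgy.le hay.le
          have h2 : ∑ j ∈ s, c j * (f j y / f i y) ≤ 0 :=
            Finset.sum_nonpos fun j hj => mul_nonpos_of_nonneg_of_nonpos (hc j)
              (div_nonpos_of_nonneg_of_nonpos (hy j hj) hay.le)
          linarith
        · simpa [hi] using hc i
      · rw [Finset.sum_insert ha, Function.update_self]
        have : ∑ i ∈ s, Function.update c a
            (g y / f a y - ∑ i ∈ s, c i * (f i y / f a y)) i • f i = ∑ i ∈ s, c i • f i :=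
          Finset.sum_congr rfl fun i hi => by
            rw [Function.update_of_ne (ne_of_mem_of_not_mem hi ha)]
        rw [this]
        ext x
        have hx := LinearMap.congr_fun hg x
        simp only [LinearMap.sub_apply, LinearMap.smul_apply, LinearMap.sum_apply, smul_eq_mul,
          LinearMap.add_apply, mul_sub, Finset.sum_sub_distrib, ← mul_assoc,
          ← Finset.sum_mul] at hx ⊢
        linear_combination hx

/-! ### The `k` largest entries of a vector -/

theorem exists_isTopK {m k : ℕ} (hkm : k ≤ m) (s : Fin m → ℝ) : ∃ I, IsTopK k s I := by
  classical
  induction k with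
  | zero => exact ⟨∅, by simp [IsTopK]⟩
  | succ k ih =>
    obtain ⟨I, hIc, hI⟩ := ih (by omega)
    have hne : (Iᶜ).Nonempty := by
      rw [← Finset.card_pos, Finset.card_compl, Fintype.card_fin]; omega
    obtain ⟨a, ha, hmax⟩ := Finset.exists_max_image Iᶜ s hne
    rw [Finset.mem_compl] at ha
    refine ⟨insert a I, by rw [Finset.card_insert_of_notMem ha, hIc], fun i hi i' hi' => ?_⟩
    rw [Finset.mem_insert, not_or] at hi'
    rcases Finset.mem_insert.1 hi with rfl | hi
    · exact hmax i' (Finset.mem_compl.2 hi'.2)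
    · exact hI i hi i' hi'.2

theorem IsTopK.comp_monotone {m k : ℕ} {s : Fin m → ℝ} {I : Finset (Fin m)} (h : IsTopK k s I)
    {f : ℝ → ℝ} (hf : Monotone f) : IsTopK k (fun i => f (s i)) I :=
  ⟨h.1, fun i hi i' hi' => hf (h.2 i hi i' hi')⟩

theorem IsTopK.add_const {m k : ℕ} {s : Fin m → ℝ} {I : Finset (Fin m)} (h : IsTopK k s I)
    (τ : ℝ) : IsTopK k (fun i => s i + τ) I :=
  h.comp_monotone (f := fun x => x + τ) fun _ _ hxy => by simpa using hxy

theorem isTopK_add_const_iff {m k : ℕ} {s : Fin m → ℝ} {I : Finset (Fin m)} (τ : ℝ) :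
    IsTopK k (fun i => s i + τ) I ↔ IsTopK k s I :=
  ⟨fun h => by simpa using h.add_const (-τ), fun h => h.add_const τ⟩

theorem NoTies.add_const {m k : ℕ} {s : Fin m → ℝ} (h : NoTies k s) (τ : ℝ) :
    NoTies k (fun i => s i + τ) := by
  intro I J hI hJ
  exact h I J ((isTopK_add_const_iff τ).1 hI) ((isTopK_add_const_iff τ).1 hJ)

/-- Without ties, the entries in the top-`k` set are strictly larger than the others. -/
theorem NoTies.lt {m k : ℕ} {s : Fin m → ℝ} (h : NoTies k s) {I : Finset (Fin m)}
    (hI : IsTopK k s I) {i i' : Fin m} (hi : i ∈ I) (hi' : i' ∉ I) : s i' < s i := by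
  classical
  refine lt_of_le_of_ne (hI.2 i hi i' hi') fun heq => ?_
  -- If the two entries were equal, exchanging the indices would give a second top-k set.
  have hJ : IsTopK k s (insert i' (I.erase i)) := by
    refine ⟨?_, fun x hx y hy => ?_⟩
    · rw [Finset.card_insert_of_notMem (fun hc => hi' (Finset.mem_of_mem_erase hc)),
        Finset.card_erase_of_mem hi, hI.1]
      have : 0 < I.card := Finset.card_pos.2 ⟨i, hi⟩
      rw [hI.1] at this
      omega
    · have hy' : y ∉ I ∨ y = i := by
        by_contra! hc
        exact hy (Finset.mem_insert_of_mem (Finset.mem_erase.2 ⟨hc.2, hc.1⟩))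
      have hyi : s y ≤ s i' := by
        rcases hy' with hy' | rfl
        · rw [heq]; exact hI.2 i hi y hy'
        · exact heq.ge
      rcases Finset.mem_insert.1 hx with rfl | hx
      · exact hyi
      · have hxI := Finset.mem_of_mem_erase hx
        exact hyi.trans (hI.2 x hxI i' hi')
  have := h _ _ hI hJ
  exact hi' (this ▸ Finset.mem_insert_self i' (I.erase i))

/-- A weighted sum with weights in `[0, 1]` of total mass at most `k` is at most the sum of the `k`
largest entries. -/
theorem IsTopK.sum_mul_le {m k : ℕ} (hk : 1 ≤ k) {x : Fin m → ℝ} {I : Finset (Fin m)}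
    (hI : IsTopK k x I) (hx : ∀ i, 0 ≤ x i) {w : Fin m → ℝ} (hw : ∀ i, 0 ≤ w i ∧ w i ≤ 1)
    (hwk : ∑ i, w i ≤ k) : ∑ i, w i * x i ≤ ∑ i ∈ I, x i := by
  classical
  obtain ⟨j, hj, hmin⟩ := Finset.exists_min_image I x
    (Finset.card_pos.1 (by rw [hI.1]; omega))
  -- Entries are measured from the threshold x j, the smallest selected one: the excess is
  -- nonnegative on I and nonpositive off it.
  have hterm : ∀ i, w i * (x i - x j) ≤ if i ∈ I then x i - x j else 0 := by
    intro i
    split_ifs with hi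
    · exact mul_le_of_le_one_left (sub_nonneg.2 (hmin i hi)) (hw i).2
    · exact mul_nonpos_of_nonneg_of_nonpos (hw i).1 (sub_nonpos.2 (hI.2 j hj i hi))
  have hsum := Finset.sum_le_sum fun i (_ : i ∈ Finset.univ) => hterm i
  rw [Finset.sum_ite_mem, Finset.univ_inter] at hsum
  simp only [mul_sub, Finset.sum_sub_distrib, ← Finset.sum_mul, Finset.sum_const, hI.1,
    nsmul_eq_mul] at hsum
  nlinarith [hx j]

/-! ### The conjugates of the regularizer over the orthant and the simplex -/

/-- The value of the conjugate over the orthant in terms of a top-`k` set `I`. -/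
noncomputable def posSqSum {m : ℕ} (γ : ℝ) (I : Finset (Fin m)) (s : Fin m → ℝ) : ℝ :=
  ∑ i ∈ I, max (s i) 0 ^ 2 / (2 * γ)

/-- Young's inequality gives s_i t_i ≤ w_i max(s_i, 0)² / (2γ) + γ t_i² / (2 w_i), and
`IsTopK.sum_mul_le` bounds the weighted sum of the first terms. Zero weights are allowed so that one
inequality serves both Ω, with w the indicator of the support, and Ψ, with w = λ. -/
theorem dotProduct_le_posSqSum_add {m k : ℕ} (hk : 1 ≤ k) {γ : ℝ} (hγ : 0 < γ) {s : Fin m → ℝ}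
    {I : Finset (Fin m)} (hI : IsTopK k s I) {t : Fin m → ℝ} (ht : t ∈ orthant m)
    {w : Fin m → ℝ} (hw : ∀ i, 0 ≤ w i ∧ w i ≤ 1) (hwt : ∀ i, w i = 0 → t i = 0)
    (hwk : ∑ i, w i ≤ k) :
    s ⬝ᵥ t ≤ posSqSum γ I s + γ * (1 / 2 * ∑ i, t i ^ 2 / w i) := by
  have hmono : Monotone fun x : ℝ => max x 0 ^ 2 / (2 * γ) := by
    intro x y hxy
    have : max x 0 ≤ max y 0 := max_le_max_right 0 hxy
    have h0 : 0 ≤ max x 0 := le_max_right _ _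
    dsimp only
    gcongr
  have h1 := (hI.comp_monotone hmono).sum_mul_le hk (fun i => by positivity) hw hwk
  refine le_trans ?_ (add_le_add_left h1 _)
  rw [Finset.mul_sum, Finset.mul_sum, ← Finset.sum_add_distrib]
  refine Finset.sum_le_sum fun i _ => ?_
  rcases (hw i).1.eq_or_lt with h0 | hpos
  · rw [hwt i h0.symm, ← h0]; simp
  · have hm : s i * t i ≤ max (s i) 0 * t i := mul_le_mul_of_nonneg_right (le_max_left _ _) (ht i)
    have hsq : w i * (max (s i) 0 ^ 2 / (2 * γ)) + γ * (1 / 2 * (t i ^ 2 / w i))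
        - max (s i) 0 * t i = (w i * max (s i) 0 - γ * t i) ^ 2 / (2 * γ * w i) := by
      field_simp
      ring
    have : 0 ≤ (w i * max (s i) 0 - γ * t i) ^ 2 / (2 * γ * w i) := by positivity
    linarith

theorem dotProduct_sub_le_posSqSum {m k : ℕ} (hk : 1 ≤ k) {γ : ℝ} (hγ : 0 < γ) {s : Fin m → ℝ}
    {I : Finset (Fin m)} (hI : IsTopK k s I) {t : Fin m → ℝ} (ht : t ∈ orthant m)
    (hts : t ∈ sparseSet m k) :
    s ⬝ᵥ t - γ / 2 * ∑ i, t i ^ 2 ≤ posSqSum γ I s := by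
  classical
  have h := dotProduct_le_posSqSum_add hk hγ hI ht (w := fun i => if t i ≠ 0 then 1 else 0)
    (fun i => by split_ifs <;> norm_num) (fun i hi => by by_contra hc; simp [hc] at hi) (by
      rw [Finset.sum_boole]
      exact_mod_cast hts)
  -- Where the weight is 0, t i is 0 too, so the convention x / 0 = 0 does no harm.
  have h2 : ∑ i, t i ^ 2 / (if t i ≠ 0 then (1 : ℝ) else 0) = ∑ i, t i ^ 2 :=
    Finset.sum_congr rfl fun i _ => by by_cases hi : t i = 0 <;> simp [hi]
  rw [h2] at h
  linarith

theorem mem_sparseSet_of_support_subset {m k : ℕ} {t : Fin m → ℝ} {I : Finset (Fin m)}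
    (hI : I.card ≤ k) (h : ∀ i ∉ I, t i = 0) : t ∈ sparseSet m k := by
  refine (Finset.card_le_card fun i hi => ?_).trans hI
  by_contra hc
  simp [h i hc] at hi

/-- The maximizer in the conjugate over the orthant. -/
noncomputable def posPartOn {m : ℕ} (γ : ℝ) (I : Finset (Fin m)) (s : Fin m → ℝ) : Fin m → ℝ :=
  open Classical in fun i => if i ∈ I then max (s i) 0 / γ else 0

theorem posPartOn_mem_orthant {m : ℕ} {γ : ℝ} (hγ : 0 < γ) (I : Finset (Fin m))
    (s : Fin m → ℝ) : posPartOn γ I s ∈ orthant m := by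
  intro i
  unfold posPartOn
  split_ifs
  · positivity
  · exact le_rfl

theorem posPartOn_mem_sparseSet {m k : ℕ} (γ : ℝ) {I : Finset (Fin m)} (hI : I.card ≤ k)
    (s : Fin m → ℝ) : posPartOn γ I s ∈ sparseSet m k :=
  mem_sparseSet_of_support_subset hI fun i hi => by simp [posPartOn, hi]

theorem sum_posPartOn {m : ℕ} (γ : ℝ) (I : Finset (Fin m)) (s : Fin m → ℝ) :
    ∑ i, posPartOn γ I s i = (∑ i ∈ I, max (s i) 0) / γ := by
  simp only [posPartOn, Finset.sum_ite_mem, Finset.univ_inter, Finset.sum_div]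

theorem dotProduct_posPartOn {m : ℕ} {γ : ℝ} (hγ : 0 < γ) (I : Finset (Fin m))
    (s : Fin m → ℝ) :
    s ⬝ᵥ posPartOn γ I s - γ / 2 * ∑ i, posPartOn γ I s i ^ 2 = posSqSum γ I s := by
  classical
  have h : ∀ i, s i * posPartOn γ I s i - γ / 2 * posPartOn γ I s i ^ 2
      = if i ∈ I then max (s i) 0 ^ 2 / (2 * γ) else 0 := by
    intro i
    unfold posPartOn
    split_ifs
    · rcases le_total (s i) 0 with h0 | h0
      · simp [h0]
      · rw [max_eq_left h0]; field_simp; ring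
    · simp
  rw [dotProduct, Finset.mul_sum, ← Finset.sum_sub_distrib, Finset.sum_congr rfl fun i _ => h i,
    Finset.sum_ite_mem, Finset.univ_inter, posSqSum]

theorem sparseReg_of_mem {m k : ℕ} (γ : ℝ) {t : Fin m → ℝ} (ht : t ∈ sparseSet m k) :
    sparseReg m k γ t = ((γ / 2 * ∑ i, t i ^ 2 : ℝ) : EReal) := by
  simp [sparseReg, indicator, ht]

theorem sparseReg_of_notMem {m k : ℕ} (γ : ℝ) {t : Fin m → ℝ} (ht : t ∉ sparseSet m k) :
    sparseReg m k γ t = ⊤ := by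
  simp only [sparseReg, indicator, ht, if_false]
  exact EReal.coe_add_top _

theorem sparseReg_ne_bot {m k : ℕ} (γ : ℝ) (t : Fin m → ℝ) : sparseReg m k γ t ≠ ⊥ := by
  by_cases ht : t ∈ sparseSet m k
  · rw [sparseReg_of_mem γ ht]; exact EReal.coe_ne_bot _
  · rw [sparseReg_of_notMem γ ht]; exact top_ne_bot

theorem sparseReg_add_indicator_of_mem {m k : ℕ} (γ : ℝ) {S : Set (Fin m → ℝ)} {t : Fin m → ℝ}
    (ht : t ∈ sparseSet m k ∩ S) :
    sparseReg m k γ t + indicator S t = ((γ / 2 * ∑ i, t i ^ 2 : ℝ) : EReal) := by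
  simp [sparseReg_of_mem γ ht.1, indicator, ht.2]

theorem sparseReg_add_indicator_of_notMem {m k : ℕ} (γ : ℝ) {S : Set (Fin m → ℝ)}
    {t : Fin m → ℝ} (ht : t ∉ sparseSet m k ∩ S) :
    sparseReg m k γ t + indicator S t = ⊤ := by
  by_cases h : t ∈ S
  · have h' : t ∉ sparseSet m k := fun hc => ht ⟨hc, h⟩
    simp [sparseReg_of_notMem γ h', indicator, h]
  · simp only [indicator, h, if_false]
    exact EReal.add_top_of_ne_bot (sparseReg_ne_bot γ t)

theorem conj_restrictOrthant {m k : ℕ} (hk : 1 ≤ k) {γ : ℝ} (hγ : 0 < γ) {s : Fin m → ℝ}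
    {I : Finset (Fin m)} (hI : IsTopK k s I) :
    conj (restrictOrthant (sparseReg m k γ)) s = (posSqSum γ I s : EReal) :=
  conj_eq_coe (S := sparseSet m k ∩ orthant m)
    (fun _ ht => sparseReg_add_indicator_of_mem γ ht)
    (fun _ ht => sparseReg_add_indicator_of_notMem γ ht)
    (fun _ ht => dotProduct_sub_le_posSqSum hk hγ hI ht.2 ht.1)
    ⟨posPartOn γ I s, ⟨posPartOn_mem_sparseSet γ hI.1.le s, posPartOn_mem_orthant hγ I s⟩,
      dotProduct_posPartOn hγ I s⟩

/-- The real value of the conjugate over the orthant. -/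
noncomputable def orthantConj (m k : ℕ) (γ : ℝ) (s : Fin m → ℝ) : ℝ :=
  (conj (restrictOrthant (sparseReg m k γ)) s).toReal

theorem orthantConj_eq {m k : ℕ} (hk : 1 ≤ k) {γ : ℝ} (hγ : 0 < γ) {s : Fin m → ℝ}
    {I : Finset (Fin m)} (hI : IsTopK k s I) : orthantConj m k γ s = posSqSum γ I s := by
  rw [orthantConj, conj_restrictOrthant hk hγ hI, EReal.toReal_coe]

theorem conj_restrictOrthant_eq_coe {m k : ℕ} (hk : 1 ≤ k) (hkm : k ≤ m) {γ : ℝ} (hγ : 0 < γ)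
    (s : Fin m → ℝ) :
    conj (restrictOrthant (sparseReg m k γ)) s = (orthantConj m k γ s : EReal) := by
  obtain ⟨I, hI⟩ := exists_isTopK hkm s
  rw [orthantConj_eq hk hγ hI, conj_restrictOrthant hk hγ hI]

/-- Intermediate value theorem in τ: with s p the largest entry, τ = -s p gives sum 0 and τ = b - s
p gives at least b. -/
theorem exists_sum_max_add_eq {ι : Type*} {I : Finset ι} (hI : I.Nonempty) (s : ι → ℝ) {b : ℝ}
    (hb : 0 ≤ b) : ∃ τ : ℝ, ∑ i ∈ I, max (s i + τ) 0 = b := by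
  have hcont : Continuous fun τ : ℝ => ∑ i ∈ I, max (s i + τ) 0 := by fun_prop
  obtain ⟨p, hp, hpmax⟩ := Finset.exists_max_image I s hI
  refine mem_range_of_exists_le_of_exists_ge hcont ⟨-s p, ?_⟩ ⟨b - s p, ?_⟩
  · refine le_of_eq_of_le (Finset.sum_eq_zero fun i hi => ?_) hb
    exact max_eq_right (by linarith [hpmax i hi])
  · refine le_trans ?_ (Finset.single_le_sum (f := fun i => max (s i + (b - s p)) 0)
      (fun i _ => le_max_right _ _) hp)
    exact le_trans (by linarith) (le_max_left _ _)

theorem dotProduct_add_const {m : ℕ} (s t : Fin m → ℝ) (τ : ℝ) :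
    (fun i => s i + τ) ⬝ᵥ t = s ⬝ᵥ t + τ * ∑ i, t i := by
  simp only [dotProduct, add_mul, Finset.sum_add_distrib, Finset.mul_sum]

/-- The conjugate over the simplex is the conjugate over the orthant at a shifted point, up to a
linear term, and the supremum that defines it is attained. -/
theorem exists_conj_restrictSimplex {m k : ℕ} (hk : 1 ≤ k) (hkm : k ≤ m) {γ : ℝ} (hγ : 0 < γ)
    {b : ℝ} (hb : 0 ≤ b) (s : Fin m → ℝ) :
    ∃ τ : ℝ, conj (restrictSimplex (sparseReg m k γ) b) s =
        ((orthantConj m k γ (fun i => s i + τ) - τ * b : ℝ) : EReal) ∧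
      ∃ t ∈ sparseSet m k ∩ scaledSimplex m b,
        s ⬝ᵥ t - γ / 2 * ∑ i, t i ^ 2 = orthantConj m k γ (fun i => s i + τ) - τ * b := by
  obtain ⟨I, hI⟩ := exists_isTopK hkm s
  -- The target γb is the value for which the maximizer over the orthant at s + τ𝟏 has mass b, hence
  -- lies in the simplex.
  obtain ⟨τ, hτ⟩ := exists_sum_max_add_eq (Finset.card_pos.1 (by rw [hI.1]; omega)) s
    (mul_nonneg hγ.le hb)
  have hIτ := hI.add_const τ
  have hval : ∃ t ∈ sparseSet m k ∩ scaledSimplex m b,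
      s ⬝ᵥ t - γ / 2 * ∑ i, t i ^ 2 = orthantConj m k γ (fun i => s i + τ) - τ * b := by
    have hsum : ∑ i, posPartOn γ I (fun i => s i + τ) i = b := by
      rw [sum_posPartOn, hτ]; field_simp
    refine ⟨_, ⟨posPartOn_mem_sparseSet γ hI.1.le _, posPartOn_mem_orthant hγ I _, hsum⟩, ?_⟩
    rw [orthantConj_eq hk hγ hIτ, ← dotProduct_posPartOn hγ, dotProduct_add_const, hsum]
    ring
  refine ⟨τ, conj_eq_coe (S := sparseSet m k ∩ scaledSimplex m b)
    (fun _ ht => sparseReg_add_indicator_of_mem γ ht)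
    (fun _ ht => sparseReg_add_indicator_of_notMem γ ht) (fun t ht => ?_) hval, hval⟩
  have h := dotProduct_sub_le_posSqSum hk hγ hIτ ht.2.1 ht.1
  rw [dotProduct_add_const, ht.2.2] at h
  rw [orthantConj_eq hk hγ hIτ]
  linarith

/-- The real value of the conjugate over the simplex. -/
noncomputable def simplexConj (m k : ℕ) (γ b : ℝ) (s : Fin m → ℝ) : ℝ :=
  (conj (restrictSimplex (sparseReg m k γ) b) s).toReal

theorem conj_restrictSimplex_eq_coe {m k : ℕ} (hk : 1 ≤ k) (hkm : k ≤ m) {γ : ℝ} (hγ : 0 < γ)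
    {b : ℝ} (hb : 0 ≤ b) (s : Fin m → ℝ) :
    conj (restrictSimplex (sparseReg m k γ) b) s = (simplexConj m k γ b s : EReal) := by
  obtain ⟨τ, hτ, -⟩ := exists_conj_restrictSimplex hk hkm hγ hb s
  rw [simplexConj, hτ, EReal.toReal_coe]

theorem exists_simplexConj_eq {m k : ℕ} (hk : 1 ≤ k) (hkm : k ≤ m) {γ : ℝ} (hγ : 0 < γ)
    {b : ℝ} (hb : 0 ≤ b) (s : Fin m → ℝ) :
    ∃ τ : ℝ, simplexConj m k γ b s = orthantConj m k γ (fun i => s i + τ) - τ * b := by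
  obtain ⟨τ, hτ, -⟩ := exists_conj_restrictSimplex hk hkm hγ hb s
  exact ⟨τ, by rw [simplexConj, hτ, EReal.toReal_coe]⟩

theorem exists_dotProduct_sub_eq_simplexConj {m k : ℕ} (hk : 1 ≤ k) (hkm : k ≤ m) {γ : ℝ}
    (hγ : 0 < γ) {b : ℝ} (hb : 0 ≤ b) (s : Fin m → ℝ) :
    ∃ t ∈ sparseSet m k ∩ scaledSimplex m b,
      s ⬝ᵥ t - γ / 2 * ∑ i, t i ^ 2 = simplexConj m k γ b s := by
  obtain ⟨τ, hτ, t, ht, htv⟩ := exists_conj_restrictSimplex hk hkm hγ hb s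
  exact ⟨t, ht, by rw [simplexConj, hτ, EReal.toReal_coe, htv]⟩

theorem dotProduct_sub_le_simplexConj {m k : ℕ} (hk : 1 ≤ k) (hkm : k ≤ m) {γ : ℝ}
    (hγ : 0 < γ) {b : ℝ} (s : Fin m → ℝ) {t : Fin m → ℝ}
    (ht : t ∈ sparseSet m k ∩ scaledSimplex m b) :
    s ⬝ᵥ t - γ / 2 * ∑ i, t i ^ 2 ≤ simplexConj m k γ b s := by
  have hb : 0 ≤ b := ht.2.2 ▸ Finset.sum_nonneg fun i _ => ht.2.1 i
  have h := le_conj (restrictSimplex (sparseReg m k γ) b) s t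
  rw [conj_restrictSimplex_eq_coe hk hkm hγ hb, restrictSimplex,
    sparseReg_add_indicator_of_mem γ ht, ← EReal.coe_sub] at h
  exact EReal.coe_le_coe_iff.1 h

theorem dotProduct_sub_le_orthantConj {m k : ℕ} (hk : 1 ≤ k) (hkm : k ≤ m) {γ : ℝ}
    (hγ : 0 < γ) (s : Fin m → ℝ) {t : Fin m → ℝ} (ht : t ∈ sparseSet m k ∩ orthant m) :
    s ⬝ᵥ t - γ / 2 * ∑ i, t i ^ 2 ≤ orthantConj m k γ s := by
  obtain ⟨I, hI⟩ := exists_isTopK hkm s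
  rw [orthantConj_eq hk hγ hI]
  exact dotProduct_sub_le_posSqSum hk hγ hI ht.2 ht.1

theorem exists_dotProduct_sub_eq_orthantConj {m k : ℕ} (hk : 1 ≤ k) (hkm : k ≤ m) {γ : ℝ}
    (hγ : 0 < γ) (s : Fin m → ℝ) :
    ∃ t ∈ sparseSet m k ∩ orthant m,
      s ⬝ᵥ t - γ / 2 * ∑ i, t i ^ 2 = orthantConj m k γ s := by
  obtain ⟨I, hI⟩ := exists_isTopK hkm s
  rw [orthantConj_eq hk hγ hI]
  exact ⟨_, ⟨posPartOn_mem_sparseSet γ hI.1.le s, posPartOn_mem_orthant hγ I s⟩,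
    dotProduct_posPartOn hγ I s⟩

/-- On the simplex, shifting s by τ changes the linear term by exactly τb, and the orthant is
larger. With `exists_simplexConj_eq`, this says that the semi-dual arises from the dual by
maximizing over β. -/
theorem simplexConj_le {m k : ℕ} (hk : 1 ≤ k) (hkm : k ≤ m) {γ : ℝ} (hγ : 0 < γ) {b : ℝ}
    (hb : 0 ≤ b) (s : Fin m → ℝ) (τ : ℝ) :
    simplexConj m k γ b s ≤ orthantConj m k γ (fun i => s i + τ) - τ * b := by
  obtain ⟨t, ht, htv⟩ := exists_dotProduct_sub_eq_simplexConj hk hkm hγ hb s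
  have h := dotProduct_sub_le_orthantConj hk hkm hγ (fun i => s i + τ) ⟨ht.1, ht.2.1⟩
  rw [dotProduct_add_const, ht.2.2] at h
  linarith

/-! ### The squared `k`-support norm -/

/-- The weights over which the squared `k`-support norm is an infimum. -/
def supportWeights (m k : ℕ) : Set (Fin m → ℝ) :=
  {l | ∑ i, l i = (k : ℝ) ∧ ∀ i, 0 < l i ∧ l i ≤ 1}

/-- The real value of the squared `k`-support norm. -/
noncomputable def kSupport (m k : ℕ) (t : Fin m → ℝ) : ℝ :=
  sInf ((fun l : Fin m → ℝ => 1 / 2 * ∑ i, t i ^ 2 / l i) '' supportWeights m k)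

theorem const_mem_supportWeights {m k : ℕ} (hk : 1 ≤ k) (hkm : k ≤ m) :
    (fun _ => (k : ℝ) / m) ∈ supportWeights m k := by
  have hk' : (0 : ℝ) < k := by exact_mod_cast hk
  have hkm' : (k : ℝ) ≤ m := by exact_mod_cast hkm
  have hm' : (0 : ℝ) < m := hk'.trans_le hkm'
  refine ⟨?_, fun i => ⟨by positivity, (div_le_one hm').2 hkm'⟩⟩
  rw [Finset.sum_const, Finset.card_univ, Fintype.card_fin, nsmul_eq_mul]
  field_simp

theorem sum_sq_div_nonneg {m k : ℕ} (t : Fin m → ℝ) {l : Fin m → ℝ}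
    (hl : l ∈ supportWeights m k) : 0 ≤ 1 / 2 * ∑ i, t i ^ 2 / l i := by
  have : 0 ≤ ∑ i, t i ^ 2 / l i :=
    Finset.sum_nonneg fun i _ => div_nonneg (sq_nonneg _) (hl.2 i).1.le
  positivity

theorem kSupport_le {m k : ℕ} (t : Fin m → ℝ) {l : Fin m → ℝ} (hl : l ∈ supportWeights m k) :
    kSupport m k t ≤ 1 / 2 * ∑ i, t i ^ 2 / l i :=
  csInf_le ⟨0, by rintro _ ⟨l, hl, rfl⟩; exact sum_sq_div_nonneg t hl⟩ ⟨l, hl, rfl⟩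

theorem le_kSupport {m k : ℕ} (hk : 1 ≤ k) (hkm : k ≤ m) {t : Fin m → ℝ} {c : ℝ}
    (h : ∀ l ∈ supportWeights m k, c ≤ 1 / 2 * ∑ i, t i ^ 2 / l i) : c ≤ kSupport m k t :=
  le_csInf ⟨_, _, const_mem_supportWeights hk hkm, rfl⟩ (by rintro _ ⟨l, hl, rfl⟩; exact h l hl)

theorem sqKSupport_eq_coe {m k : ℕ} (hk : 1 ≤ k) (hkm : k ≤ m) (t : Fin m → ℝ) :
    sqKSupport m k t = (kSupport m k t : EReal) := by
  refine le_antisymm ?_ (le_iInf₂ fun l hl => EReal.coe_le_coe_iff.2 (kSupport_le t hl))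
  have hle : ∀ l ∈ supportWeights m k,
      sqKSupport m k t ≤ ((1 / 2 * ∑ i, t i ^ 2 / l i : ℝ) : EReal) := fun l hl => iInf₂_le l hl
  have htop : sqKSupport m k t ≠ ⊤ :=
    ne_top_of_le_ne_top (EReal.coe_ne_top _) (hle _ (const_mem_supportWeights hk hkm))
  have hbot : sqKSupport m k t ≠ ⊥ := by
    refine ne_bot_of_le_ne_bot (EReal.coe_ne_bot 0) (le_iInf₂ fun l hl => ?_)
    exact EReal.coe_le_coe_iff.2 (sum_sq_div_nonneg t hl)
  rw [← EReal.coe_toReal htop hbot] at hle ⊢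
  exact EReal.coe_le_coe_iff.2 (le_kSupport hk hkm fun l hl => EReal.coe_le_coe_iff.1 (hle l hl))

theorem half_sum_sq_le_kSupport {m k : ℕ} (hk : 1 ≤ k) (hkm : k ≤ m) (t : Fin m → ℝ) :
    1 / 2 * ∑ i, t i ^ 2 ≤ kSupport m k t := by
  refine le_kSupport hk hkm fun l hl => ?_
  have : ∑ i, t i ^ 2 ≤ ∑ i, t i ^ 2 / l i :=
    Finset.sum_le_sum fun i _ => le_div_self (sq_nonneg _) (hl.2 i).1 (hl.2 i).2
  linarith

/-- The ideal weight is the indicator of a k-set I containing the support, but weights must be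
positive. It is therefore mixed with the constant weight k/m in proportion ε, and ε tends to 0. -/
theorem kSupport_le_half_sum_sq {m k : ℕ} (hk : 1 ≤ k) (hkm : k ≤ m) {t : Fin m → ℝ}
    (ht : t ∈ sparseSet m k) : kSupport m k t ≤ 1 / 2 * ∑ i, t i ^ 2 := by
  classical
  obtain ⟨I, hIt, hI⟩ := Finset.exists_superset_card_eq (s := Finset.univ.filter fun i => t i ≠ 0)
    (n := k) ht (by simpa using hkm)
  have hc := const_mem_supportWeights hk hkm
  have key : ∀ ε : ℝ, 0 < ε → ε < 1 → kSupport m k t * (1 - ε) ≤ 1 / 2 * ∑ i, t i ^ 2 := by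
    intro ε h0 h1
    have h1' : 0 < 1 - ε := by linarith
    have hk0 : (0 : ℝ) < k / m := (hc.2 ⟨0, by omega⟩).1
    have hk1 : (k : ℝ) / m ≤ 1 := (hc.2 ⟨0, by omega⟩).2
    have hl : (fun i => (1 - ε) * (if i ∈ I then 1 else 0) + ε * ((k : ℝ) / m))
        ∈ supportWeights m k := by
      refine ⟨?_, fun i => ?_⟩
      · rw [Finset.sum_add_distrib, ← Finset.mul_sum, ← Finset.mul_sum, hc.1]
        simp only [Finset.sum_boole, Finset.filter_univ_mem, hI]
        ring
      · dsimp only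
        split_ifs <;> constructor <;> nlinarith
    have hle := kSupport_le t hl
    have hterm : ∑ i, t i ^ 2 / ((1 - ε) * (if i ∈ I then 1 else 0) + ε * ((k : ℝ) / m))
        ≤ ∑ i, t i ^ 2 / (1 - ε) := by
      refine Finset.sum_le_sum fun i _ => ?_
      by_cases hi : i ∈ I
      · simp only [hi, if_true, mul_one]
        have : 1 - ε ≤ 1 - ε + ε * ((k : ℝ) / m) := by nlinarith
        gcongr
      · have : t i = 0 := by
          by_contra hc
          exact hi (hIt (by simp [hc]))
        simp [this]
    rw [← Finset.sum_div] at hterm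
    have h2 : kSupport m k t ≤ 1 / 2 * ((∑ i, t i ^ 2) / (1 - ε)) := by linarith
    calc kSupport m k t * (1 - ε) ≤ 1 / 2 * ((∑ i, t i ^ 2) / (1 - ε)) * (1 - ε) := by gcongr
      _ = _ := by field_simp
  have hlim : Filter.Tendsto (fun ε : ℝ => kSupport m k t * (1 - ε)) (nhdsWithin 0 (Set.Ioi 0))
      (nhds (kSupport m k t)) := by
    have : Continuous fun ε : ℝ => kSupport m k t * (1 - ε) := by fun_prop
    simpa using (this.tendsto 0).mono_left nhdsWithin_le_nhds
  refine le_of_tendsto hlim ?_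
  filter_upwards [Ioo_mem_nhdsGT (zero_lt_one' ℝ)] with ε hε
  exact key ε hε.1 hε.2

/-- Joint convexity of x² / p for p > 0: after clearing the denominator, the defect is a multiple of
(xq - yp)². -/
theorem sq_add_div_add_le {x y p q u v : ℝ} (hp : 0 < p) (hq : 0 < q) (hu : 0 ≤ u) (hv : 0 ≤ v)
    (huv : u + v = 1) :
    (u * x + v * y) ^ 2 / (u * p + v * q) ≤ u * (x ^ 2 / p) + v * (y ^ 2 / q) := by
  have hpos : 0 < u * p + v * q := by
    rcases hu.eq_or_lt with rfl | hu
    · have : v = 1 := by linarith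
      subst this; linarith
    · have := mul_nonneg hv hq.le
      have := mul_pos hu hp
      linarith
  rw [div_le_iff₀ hpos]
  have : (u * (x ^ 2 / p) + v * (y ^ 2 / q)) * (u * p + v * q) - (u * x + v * y) ^ 2
      = u * v * (x * q - y * p) ^ 2 / (p * q) := by
    field_simp
    ring
  have h2 : 0 ≤ u * v * (x * q - y * p) ^ 2 / (p * q) := by positivity
  linarith

/-- Partial infimum of a jointly convex function over a convex set of weights. The infimum need not
be attained, so ε-optimal weights are combined. -/
theorem convexOn_kSupport {m k : ℕ} (hk : 1 ≤ k) (hkm : k ≤ m) :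
    ConvexOn ℝ Set.univ (kSupport m k) := by
  refine ⟨convex_univ, fun x _ y _ u v hu hv huv => ?_⟩
  refine le_of_forall_pos_le_add fun ε hε => ?_
  have happrox : ∀ t : Fin m → ℝ, ∃ l ∈ supportWeights m k,
      1 / 2 * ∑ i, t i ^ 2 / l i < kSupport m k t + ε := by
    intro t
    by_contra! h
    linarith [le_kSupport hk hkm h]
  obtain ⟨p, hp, hpx⟩ := happrox x
  obtain ⟨q, hq, hqy⟩ := happrox y
  have hl : u • p + v • q ∈ supportWeights m k := by
    refine ⟨?_, fun i => ?_⟩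
    · simp only [Pi.add_apply, Pi.smul_apply, smul_eq_mul, Finset.sum_add_distrib,
        ← Finset.mul_sum, hp.1, hq.1]
      rw [← add_mul, huv, one_mul]
    · exact ⟨(convex_Ioi (0 : ℝ)) (hp.2 i).1 (hq.2 i).1 hu hv huv,
        (convex_Iic (1 : ℝ)) (hp.2 i).2 (hq.2 i).2 hu hv huv⟩
  have h1 := kSupport_le (u • x + v • y) hl
  have h2 : ∑ i, (u • x + v • y) i ^ 2 / (u • p + v • q) i ≤
      u * ∑ i, x i ^ 2 / p i + v * ∑ i, y i ^ 2 / q i := by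
    rw [Finset.mul_sum, Finset.mul_sum, ← Finset.sum_add_distrib]
    exact Finset.sum_le_sum fun i _ => sq_add_div_add_le (hp.2 i).1 (hq.2 i).1 hu hv huv
  simp only [smul_eq_mul]
  have hv' : v = 1 - u := by linarith
  have h3 := mul_le_mul_of_nonneg_left hpx.le hu
  have h4 := mul_le_mul_of_nonneg_left hqy.le hv
  have h5 : u * (kSupport m k x + ε) + v * (kSupport m k y + ε)
      = u * kSupport m k x + v * kSupport m k y + ε := by rw [hv']; ring
  linarith

theorem continuous_kSupport {m k : ℕ} (hk : 1 ≤ k) (hkm : k ≤ m) : Continuous (kSupport m k) :=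
  continuousOn_univ.1 ((convexOn_kSupport hk hkm).continuousOn isOpen_univ)

/-- The Fenchel-Young inequality for `γ Ψ` and the conjugate over the orthant. -/
theorem dotProduct_le_orthantConj_add {m k : ℕ} (hk : 1 ≤ k) (hkm : k ≤ m) {γ : ℝ} (hγ : 0 < γ)
    (s : Fin m → ℝ) {t : Fin m → ℝ} (ht : t ∈ orthant m) :
    s ⬝ᵥ t ≤ orthantConj m k γ s + γ * kSupport m k t := by
  obtain ⟨I, hI⟩ := exists_isTopK hkm s
  have h : (s ⬝ᵥ t - orthantConj m k γ s) / γ ≤ kSupport m k t := by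
    refine le_kSupport hk hkm fun l hl => ?_
    have := dotProduct_le_posSqSum_add hk hγ hI ht (fun i => ⟨(hl.2 i).1.le, (hl.2 i).2⟩)
      (fun i hi => absurd hi (hl.2 i).1.ne') hl.1.le
    rw [div_le_iff₀ hγ, orthantConj_eq hk hγ hI]
    linarith
  rw [div_le_iff₀ hγ] at h
  linarith

theorem dotProduct_le_simplexConj_add {m k : ℕ} (hk : 1 ≤ k) (hkm : k ≤ m) {γ : ℝ} (hγ : 0 < γ)
    {b : ℝ} (s : Fin m → ℝ) {t : Fin m → ℝ} (ht : t ∈ scaledSimplex m b) :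
    s ⬝ᵥ t ≤ simplexConj m k γ b s + γ * kSupport m k t := by
  have hb : 0 ≤ b := ht.2 ▸ Finset.sum_nonneg fun i _ => ht.1 i
  obtain ⟨τ, hτ⟩ := exists_simplexConj_eq hk hkm hγ hb s
  have h := dotProduct_le_orthantConj_add hk hkm hγ (fun i => s i + τ) ht.1
  rw [dotProduct_add_const, ht.2] at h
  linarith

theorem linearMap_apply_eq_dotProduct {m : ℕ} (g : (Fin m → ℝ) →ₗ[ℝ] ℝ) (t : Fin m → ℝ) :
    g t = (fun i => g (Pi.single i 1)) ⬝ᵥ t := by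
  rw [LinearMap.pi_apply_eq_sum_univ g t, dotProduct]
  refine Finset.sum_congr rfl fun i _ => ?_
  rw [smul_eq_mul, mul_comm]
  congr 2
  ext j
  simp [Pi.single_apply, eq_comm]

theorem exists_subgradient_kSupport {m k : ℕ} (hk : 1 ≤ k) (hkm : k ≤ m) {γ : ℝ} (hγ : 0 < γ)
    (t : Fin m → ℝ) : ∃ g : Fin m → ℝ,
      ∀ t', γ * kSupport m k t + (g ⬝ᵥ t' - g ⬝ᵥ t) ≤ γ * kSupport m k t' := by
  obtain ⟨g, hg, -⟩ := exists_subgradient_isMinOn (F := fun t => γ * kSupport m k t)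
    ((convexOn_kSupport hk hkm).smul hγ.le) ((continuous_kSupport hk hkm).const_mul γ)
    (convex_singleton t) (Set.mem_singleton t) (by rintro y rfl; exact le_rfl)
  refine ⟨fun i => g (Pi.single i 1), fun t' => ?_⟩
  rw [← linearMap_apply_eq_dotProduct, ← linearMap_apply_eq_dotProduct]
  exact hg t'

/-- The conjugate is attained at a sparse x ≥ 0, where γΨ(x) ≤ Ω(x), so the subgradient inequality
at x suffices. The slack s ≤ g is needed because the potentials of `exists_potentials` only lie
below the subgradient. -/
theorem orthantConj_le_of_subgradient {m k : ℕ} (hk : 1 ≤ k) (hkm : k ≤ m) {γ : ℝ} (hγ : 0 < γ)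
    {t g s : Fin m → ℝ} (hg : ∀ t', γ * kSupport m k t + (g ⬝ᵥ t' - g ⬝ᵥ t) ≤ γ * kSupport m k t')
    (hs : ∀ i, s i ≤ g i) : orthantConj m k γ s ≤ g ⬝ᵥ t - γ * kSupport m k t := by
  obtain ⟨x, hx, hxv⟩ := exists_dotProduct_sub_eq_orthantConj hk hkm hγ s
  have h1 := mul_le_mul_of_nonneg_left (kSupport_le_half_sum_sq hk hkm hx.1) hγ.le
  have h2 : s ⬝ᵥ x ≤ g ⬝ᵥ x :=
    Finset.sum_le_sum fun i _ => mul_le_mul_of_nonneg_right (hs i) (hx.2 i)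
  linarith [hg x]

theorem simplexConj_le_of_subgradient {m k : ℕ} (hk : 1 ≤ k) (hkm : k ≤ m) {γ : ℝ} (hγ : 0 < γ)
    {b : ℝ} (hb : 0 ≤ b) {t g : Fin m → ℝ}
    (hg : ∀ t', γ * kSupport m k t + (g ⬝ᵥ t' - g ⬝ᵥ t) ≤ γ * kSupport m k t') :
    simplexConj m k γ b g ≤ g ⬝ᵥ t - γ * kSupport m k t := by
  obtain ⟨x, hx, hxv⟩ := exists_dotProduct_sub_eq_simplexConj hk hkm hγ hb g
  have h1 := mul_le_mul_of_nonneg_left (kSupport_le_half_sum_sq hk hkm hx.1) hγ.le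
  linarith [hg x]

/-- Equality in the Fenchel-Young inequality at a point without ties forces sparsity. -/
theorem mem_sparseSet_of_noTies {m k : ℕ} (hk : 1 ≤ k) (hkm : k ≤ m) {γ : ℝ} (hγ : 0 < γ)
    {s t : Fin m → ℝ} (hs : NoTies k s) (ht : t ∈ orthant m)
    (heq : orthantConj m k γ s + γ * kSupport m k t ≤ s ⬝ᵥ t) : t ∈ sparseSet m k := by
  classical
  obtain ⟨I, hI⟩ := exists_isTopK hkm s
  refine mem_sparseSet_of_support_subset hI.1.le fun j hj => ?_
  by_contra hne
  have htj : 0 < t j := lt_of_le_of_ne (ht j) (Ne.symm hne)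
  obtain ⟨p, hp, hpmin⟩ := Finset.exists_min_image I s (Finset.card_pos.1 (by rw [hI.1]; omega))
  have hlt : s j < s p := hs.lt hI hp hj
  -- If t j > 0 off I, raising s j to the smallest selected entry keeps I a top-k set, so the
  -- conjugate is unchanged while the linear term grows strictly. This violates Fenchel-Young.
  have hI' : IsTopK k (Function.update s j (s p)) I := by
    refine ⟨hI.1, fun i hi i' hi' => ?_⟩
    rw [Function.update_of_ne (ne_of_mem_of_not_mem hi hj)]
    by_cases hij : i' = j
    · subst hij; rw [Function.update_self]; exact hpmin i hi
    · rw [Function.update_of_ne hij]; exact hI.2 i hi i' hi'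
  have hval : orthantConj m k γ (Function.update s j (s p)) = orthantConj m k γ s := by
    rw [orthantConj_eq hk hγ hI', orthantConj_eq hk hγ hI]
    refine Finset.sum_congr rfl fun i hi => ?_
    rw [Function.update_of_ne (ne_of_mem_of_not_mem hi hj)]
  have hfy := dotProduct_le_orthantConj_add hk hkm hγ (Function.update s j (s p)) ht
  have hdot : Function.update s j (s p) ⬝ᵥ t = s ⬝ᵥ t + (s p - s j) * t j := by
    have : Function.update s j (s p) = s + Pi.single j (s p - s j) := by
      ext i
      by_cases hij : i = j
      · subst hij; simp
      · simp [hij]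
    rw [this, add_dotProduct, single_dotProduct]
  rw [hval, hdot] at hfy
  nlinarith [mul_pos (sub_pos.2 hlt) htj]

/-! ### Biconjugates -/

theorem conj_conj_restrictOrthant {m k : ℕ} (hk : 1 ≤ k) (hkm : k ≤ m) {γ : ℝ} (hγ : 0 < γ)
    {t : Fin m → ℝ} (ht : t ∈ orthant m) :
    conj (conj (restrictOrthant (sparseReg m k γ))) t = ((γ * kSupport m k t : ℝ) : EReal) := by
  obtain ⟨g, hg⟩ := exists_subgradient_kSupport hk hkm hγ t
  have hle : ∀ s, t ⬝ᵥ s - orthantConj m k γ s ≤ γ * kSupport m k t := fun s => by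
    rw [dotProduct_comm]
    linarith [dotProduct_le_orthantConj_add hk hkm hγ s ht]
  refine conj_eq_coe (S := Set.univ) (q := orthantConj m k γ)
    (fun s _ => conj_restrictOrthant_eq_coe hk hkm hγ s) (fun s hs => absurd trivial hs)
    (fun s _ => hle s) ⟨g, trivial, le_antisymm (hle g) ?_⟩
  rw [dotProduct_comm]
  linarith [orthantConj_le_of_subgradient hk hkm hγ hg fun _ => le_rfl]

theorem conj_conj_restrictSimplex {m k : ℕ} (hk : 1 ≤ k) (hkm : k ≤ m) {γ : ℝ} (hγ : 0 < γ)
    {b : ℝ} {t : Fin m → ℝ} (ht : t ∈ scaledSimplex m b) :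
    conj (conj (restrictSimplex (sparseReg m k γ) b)) t =
      ((γ * kSupport m k t : ℝ) : EReal) := by
  have hb : 0 ≤ b := ht.2 ▸ Finset.sum_nonneg fun i _ => ht.1 i
  obtain ⟨g, hg⟩ := exists_subgradient_kSupport hk hkm hγ t
  have hle : ∀ s, t ⬝ᵥ s - simplexConj m k γ b s ≤ γ * kSupport m k t := fun s => by
    rw [dotProduct_comm]
    linarith [dotProduct_le_simplexConj_add hk hkm hγ s ht]
  refine conj_eq_coe (S := Set.univ) (q := simplexConj m k γ b)
    (fun s _ => conj_restrictSimplex_eq_coe hk hkm hγ hb s) (fun s hs => absurd trivial hs)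
    (fun s _ => hle s) ⟨g, trivial, le_antisymm (hle g) ?_⟩
  rw [dotProduct_comm]
  linarith [simplexConj_le_of_subgradient hk hkm hγ hb hg]

theorem conj_sparseReg_add_indicator_le {m k : ℕ} {γ : ℝ} (hγ : 0 < γ) {S : Set (Fin m → ℝ)}
    {s : Fin m → ℝ} {c : ℝ} (h : ∀ t ∈ S, s ⬝ᵥ t ≤ c) :
    conj (fun t => sparseReg m k γ t + indicator S t) s ≤ (c : EReal) := by
  refine conj_le_coe (S := sparseSet m k ∩ S)
    (fun t ht => sparseReg_add_indicator_of_mem γ ht)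
    (fun t ht => sparseReg_add_indicator_of_notMem γ ht) fun t ht => ?_
  have : 0 ≤ γ / 2 * ∑ i, t i ^ 2 := by positivity
  linarith [h t ht.2]

/-- A linear functional bounded by `r` on `S` but not at `t` witnesses that the biconjugate of a
regularizer restricted to `S` is `+∞` at `t`. -/
theorem conj_conj_eq_top_of_separated {m k : ℕ} {γ : ℝ} (hγ : 0 < γ) {S : Set (Fin m → ℝ)}
    {t d : Fin m → ℝ} {r : ℝ} (hS : ∀ x ∈ S, d ⬝ᵥ x ≤ r) (hr : r < d ⬝ᵥ t) :
    conj (conj fun t => sparseReg m k γ t + indicator S t) t = ⊤ := by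
  refine conj_eq_top_of_ray (d := d) (r := r) (fun N hN => ?_) hr
  refine conj_sparseReg_add_indicator_le hγ fun x hx => ?_
  rw [smul_dotProduct, smul_eq_mul]
  exact mul_le_mul_of_nonneg_left (hS x hx) hN

theorem conj_conj_restrictOrthant_eq_top {m k : ℕ} {γ : ℝ} (hγ : 0 < γ) {t : Fin m → ℝ}
    (ht : t ∉ orthant m) : conj (conj (restrictOrthant (sparseReg m k γ))) t = ⊤ := by
  simp only [orthant, Set.mem_ofPred_eq, not_forall, not_le] at ht
  obtain ⟨i, hi⟩ := ht
  refine conj_conj_eq_top_of_separated (d := Pi.single i (-1)) (r := 0) hγ (fun x hx => ?_) ?_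
  · simpa using hx i
  · simpa using hi

theorem conj_conj_restrictSimplex_eq_top {m k : ℕ} {γ : ℝ} (hγ : 0 < γ) {b : ℝ} {t : Fin m → ℝ}
    (ht : t ∉ scaledSimplex m b) :
    conj (conj (restrictSimplex (sparseReg m k γ) b)) t = ⊤ := by
  by_cases hneg : ∃ i, t i < 0
  · obtain ⟨i, hi⟩ := hneg
    refine conj_conj_eq_top_of_separated (d := Pi.single i (-1)) (r := 0) hγ (fun x hx => ?_) ?_
    · simpa using hx.1 i
    · simpa using hi
  · push Not at hneg
    have hne : ∑ i, t i ≠ b := fun hc => ht ⟨hneg, hc⟩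
    have hdot : ∀ (c : ℝ) (x : Fin m → ℝ), (fun _ => c) ⬝ᵥ x = c * ∑ i, x i := fun c x => by
      rw [dotProduct, Finset.mul_sum]
    rcases lt_or_gt_of_ne hne with hlt | hgt
    · refine conj_conj_eq_top_of_separated (d := fun _ => -1) (r := -b) hγ (fun x hx => ?_) ?_
      · rw [hdot, hx.2]; linarith
      · rw [hdot]; linarith
    · refine conj_conj_eq_top_of_separated (d := fun _ => 1) (r := b) hγ (fun x hx => ?_) ?_
      · rw [hdot, hx.2]; linarith
      · rw [hdot]; linarith

/-! ### The transportation polytope -/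

theorem col_mem_scaledSimplex {m n : ℕ} {a : Fin m → ℝ} {b : Fin n → ℝ}
    {T : Matrix (Fin m) (Fin n) ℝ} (hT : T ∈ transportPolytope a b) (j : Fin n) :
    (fun i => T i j) ∈ scaledSimplex m (b j) :=
  ⟨fun i => hT.1 i j, hT.2.2 j⟩

theorem convex_transportPolytope {m n : ℕ} (a : Fin m → ℝ) (b : Fin n → ℝ) :
    Convex ℝ (transportPolytope a b) := by
  intro x hx y hy u v hu hv huv
  refine ⟨fun i j => ?_, fun i => ?_, fun j => ?_⟩
  · exact add_nonneg (mul_nonneg hu (hx.1 i j)) (mul_nonneg hv (hy.1 i j))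
  · simp only [Matrix.add_apply, Matrix.smul_apply, smul_eq_mul, Finset.sum_add_distrib,
      ← Finset.mul_sum, hx.2.1, hy.2.1]
    rw [← add_mul, huv, one_mul]
  · simp only [Matrix.add_apply, Matrix.smul_apply, smul_eq_mul, Finset.sum_add_distrib,
      ← Finset.mul_sum, hx.2.2, hy.2.2]
    rw [← add_mul, huv, one_mul]

theorem isCompact_transportPolytope {m n : ℕ} (a : Fin m → ℝ) (b : Fin n → ℝ) :
    IsCompact (transportPolytope a b) := by
  have hbox : IsCompact (Set.Icc (fun _ _ => 0) fun i _ => a i : Set (Fin m → Fin n → ℝ)) :=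
    isCompact_Icc
  refine IsCompact.of_isClosed_subset hbox ?_ fun T hT =>
    ⟨fun i j => hT.1 i j, fun i j => ?_⟩
  · have hclosed : IsClosed {T : Fin m → Fin n → ℝ |
        (∀ i j, 0 ≤ T i j) ∧ (∀ i, ∑ j, T i j = a i) ∧ ∀ j, ∑ i, T i j = b j} := by
      simp only [Set.ofPred_and, Set.ofPred_forall]
      refine ((isClosed_iInter fun i => isClosed_iInter fun j => ?_).inter
        ((isClosed_iInter fun i => ?_).inter (isClosed_iInter fun j => ?_)))
      · exact isClosed_le continuous_const (by fun_prop)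
      · exact isClosed_eq (by fun_prop) continuous_const
      · exact isClosed_eq (by fun_prop) continuous_const
    exact hclosed
  · calc T i j ≤ ∑ j, T i j :=
          Finset.single_le_sum (f := fun j => T i j) (fun j _ => hT.1 i j) (Finset.mem_univ j)
      _ = a i := hT.2.1 i

theorem transportPolytope_nonempty {m n : ℕ} {a : Fin m → ℝ} {b : Fin n → ℝ}
    (ha : a ∈ stdSimplex ℝ (Fin m)) (hb : b ∈ stdSimplex ℝ (Fin n)) :
    (transportPolytope a b).Nonempty := by
  refine ⟨Matrix.of fun i j => a i * b j, fun i j => mul_nonneg (ha.1 i) (hb.1 j), fun i => ?_,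
    fun j => ?_⟩
  · simp only [Matrix.of_apply, ← Finset.mul_sum, hb.2, mul_one]
  · simp only [Matrix.of_apply, ← Finset.sum_mul, ha.2, one_mul]

/-- Linear programming duality for transportation problems: a linear functional minimized at `T`
over the transportation polytope admits dual potentials with the same value. -/
theorem exists_potentials {m n : ℕ} {a : Fin m → ℝ} {b : Fin n → ℝ}
    {T : Matrix (Fin m) (Fin n) ℝ} (hT : T ∈ transportPolytope a b)
    (g : Matrix (Fin m) (Fin n) ℝ →ₗ[ℝ] ℝ) (hmin : ∀ T' ∈ transportPolytope a b, g T ≤ g T') :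
    ∃ (α : Fin m → ℝ) (β : Fin n → ℝ),
      (∀ i j, α i + β j ≤ g (Matrix.single i j 1)) ∧ g T = α ⬝ᵥ a + β ⬝ᵥ b := by
  classical
  let e : Fin m → Fin n → Matrix (Fin m) (Fin n) ℝ →ₗ[ℝ] ℝ := fun i j =>
    Matrix.entryLinearMap ℝ ℝ i j
  let act : Fin m × Fin n → Matrix (Fin m) (Fin n) ℝ →ₗ[ℝ] ℝ := fun p =>
    if T p.1 p.2 = 0 then e p.1 p.2 else 0
  let mar : Fin m ⊕ Fin n → Matrix (Fin m) (Fin n) ℝ →ₗ[ℝ] ℝ :=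
    Sum.elim (fun i => ∑ j, e i j) (fun j => ∑ i, e i j)
  have hactT : ∀ p, act p T = 0 := by
    intro p
    by_cases hp : T p.1 p.2 = 0 <;> simp [act, e, hp]
  -- The constraints describe the feasible directions at T: entries that vanish in T may not
  -- decrease, and the marginals, imposed with both signs, stay fixed.
  obtain ⟨c, hc, hg⟩ := farkas Finset.univ (Sum.elim act (Sum.elim mar (-mar))) g (by
    intro D hD
    have hact : ∀ i j, T i j = 0 → 0 ≤ D i j := fun i j hij => by
      simpa [act, e, hij] using hD (Sum.inl (i, j)) (Finset.mem_univ _)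
    have hmar : ∀ q, mar q D = 0 := fun q => by
      have h1 := hD (Sum.inr (Sum.inl q)) (Finset.mem_univ _)
      have h2 := hD (Sum.inr (Sum.inr q)) (Finset.mem_univ _)
      simp only [Sum.elim_inr, Sum.elim_inl, Pi.neg_apply, LinearMap.neg_apply] at h1 h2
      linarith
    have hrow : ∀ i, ∑ j, D i j = 0 := fun i => by
      simpa [mar, e, LinearMap.sum_apply] using hmar (Sum.inl i)
    have hcol : ∀ j, ∑ i, D i j = 0 := fun j => by
      simpa [mar, e, LinearMap.sum_apply] using hmar (Sum.inr j)
    -- A feasible direction can be followed for a short time, so minimality at T makes g nonnegative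
    -- on it.
    have hev : ∀ᶠ ε in nhdsWithin (0 : ℝ) (Set.Ioi 0), ∀ i j, 0 ≤ T i j + ε * D i j := by
      refine Filter.eventually_all.2 fun i => Filter.eventually_all.2 fun j => ?_
      rcases (hT.1 i j).eq_or_lt with h0 | hpos
      · filter_upwards [self_mem_nhdsWithin] with ε hε
        rw [← h0, zero_add]
        exact mul_nonneg (le_of_lt hε) (hact i j h0.symm)
      · have hcont : Continuous fun ε : ℝ => T i j + ε * D i j := by fun_prop
        have hlim : Filter.Tendsto (fun ε : ℝ => T i j + ε * D i j)
            (nhdsWithin 0 (Set.Ioi 0)) (nhds (T i j)) := by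
          simpa using (hcont.tendsto 0).mono_left nhdsWithin_le_nhds
        exact (hlim.eventually (lt_mem_nhds hpos)).mono fun ε hε => le_of_lt hε
    obtain ⟨ε, hε, hε0⟩ := (hev.and self_mem_nhdsWithin).exists
    have hmem : T + ε • D ∈ transportPolytope a b := by
      refine ⟨fun i j => hε i j, fun i => ?_, fun j => ?_⟩
      · simp only [Matrix.add_apply, Matrix.smul_apply, smul_eq_mul, Finset.sum_add_distrib,
          ← Finset.mul_sum, hT.2.1, hrow, mul_zero, add_zero]
      · simp only [Matrix.add_apply, Matrix.smul_apply, smul_eq_mul, Finset.sum_add_distrib,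
          ← Finset.mul_sum, hT.2.2, hcol, mul_zero, add_zero]
    have h := hmin _ hmem
    rw [map_add, map_smul, smul_eq_mul] at h
    exact nonneg_of_mul_nonneg_right (by linarith) hε0)
  -- The marginal multipliers are the potentials. The remaining terms are nonnegative on matrix
  -- units and vanish at T, which is complementary slackness.
  have hexp : ∀ D, g D = ∑ p, c (Sum.inl p) * act p D
      + (∑ i, (c (Sum.inr (Sum.inl (Sum.inl i))) - c (Sum.inr (Sum.inr (Sum.inl i)))) * ∑ j, D i j
      + ∑ j, (c (Sum.inr (Sum.inl (Sum.inr j))) - c (Sum.inr (Sum.inr (Sum.inr j))))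
        * ∑ i, D i j) := by
    intro D
    rw [hg]
    simp only [LinearMap.sum_apply, LinearMap.add_apply, LinearMap.smul_apply, Fintype.sum_sum_type, Sum.elim_inl,
      Sum.elim_inr, Pi.neg_apply, LinearMap.neg_apply, smul_eq_mul, mar, e,
      Matrix.entryLinearMap_apply, sub_mul, Finset.sum_sub_distrib, mul_neg,
      Finset.sum_neg_distrib]
    ring
  refine ⟨fun i => c (Sum.inr (Sum.inl (Sum.inl i))) - c (Sum.inr (Sum.inr (Sum.inl i))),
    fun j => c (Sum.inr (Sum.inl (Sum.inr j))) - c (Sum.inr (Sum.inr (Sum.inr j))),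
    fun i j => ?_, ?_⟩
  · rw [hexp]
    have h1 : 0 ≤ ∑ p, c (Sum.inl p) * act p (Matrix.single i j 1) := by
      refine Finset.sum_nonneg fun p _ => mul_nonneg (hc _) ?_
      by_cases hp : T p.1 p.2 = 0
      · simp only [act, hp, if_true, e, Matrix.entryLinearMap_apply, Matrix.single_apply]
        split_ifs <;> norm_num
      · simp [act, hp]
    have h2 : ∀ i', ∑ j', (Matrix.single i j (1 : ℝ)) i' j' = if i' = i then 1 else 0 := by
      intro i'
      by_cases h : i' = i
      · subst h; simp [Matrix.single_apply]
      · simp [h, Ne.symm h]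
    have h3 : ∀ j', ∑ i', (Matrix.single i j (1 : ℝ)) i' j' = if j' = j then 1 else 0 := by
      intro j'
      by_cases h : j' = j
      · subst h; simp [Matrix.single_apply]
      · simp [h, Ne.symm h]
    simp only [h2, h3, mul_ite, mul_one, mul_zero, Finset.sum_ite_eq', Finset.mem_univ, if_true]
    linarith
  · rw [hexp T]
    simp only [hactT, mul_zero, Finset.sum_const_zero, zero_add, hT.2.1, hT.2.2, dotProduct]

theorem linearMap_apply_eq_sum_single {m n : ℕ} (g : Matrix (Fin m) (Fin n) ℝ →ₗ[ℝ] ℝ)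
    (T : Matrix (Fin m) (Fin n) ℝ) :
    g T = ∑ j, (fun i => g (Matrix.single i j 1)) ⬝ᵥ fun i => T i j := by
  conv_lhs => rw [Matrix.matrix_eq_sum_single T]
  rw [Finset.sum_comm, map_sum]
  refine Finset.sum_congr rfl fun j _ => ?_
  rw [map_sum]
  refine Finset.sum_congr rfl fun i _ => ?_
  rw [mul_comm, ← smul_eq_mul, ← map_smul, Matrix.smul_single, smul_eq_mul, mul_one]

/-! ### Duality with the squared `k`-support norm -/

/-- The real value of the relaxed primal objective. -/
noncomputable def relaxedObj {m n : ℕ} (k : ℕ) (γ : ℝ) (C T : Matrix (Fin m) (Fin n) ℝ) : ℝ :=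
  (∑ i, ∑ j, T i j * C i j) + ∑ j, γ * kSupport m k (fun i => T i j)

/-- The real value of the dual objective. -/
noncomputable def dualVal {m n : ℕ} (k : ℕ) (γ : ℝ) (a : Fin m → ℝ) (b : Fin n → ℝ)
    (C : Matrix (Fin m) (Fin n) ℝ) (α : Fin m → ℝ) (β : Fin n → ℝ) : ℝ :=
  α ⬝ᵥ a + β ⬝ᵥ b - ∑ j, orthantConj m k γ (fun i => α i + β j - C i j)

/-- The real value of the semi-dual objective. -/
noncomputable def semiDualVal {m n : ℕ} (k : ℕ) (γ : ℝ) (a : Fin m → ℝ) (b : Fin n → ℝ)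
    (C : Matrix (Fin m) (Fin n) ℝ) (α : Fin m → ℝ) : ℝ :=
  α ⬝ᵥ a - ∑ j, simplexConj m k γ (b j) (fun i => α i - C i j)

theorem sum_col_dotProduct {m n : ℕ} {a : Fin m → ℝ} {T : Matrix (Fin m) (Fin n) ℝ}
    (hT : ∀ i, ∑ j, T i j = a i) (C : Matrix (Fin m) (Fin n) ℝ) (α : Fin m → ℝ) :
    ∑ j, (fun i => α i - C i j) ⬝ᵥ (fun i => T i j) =
      α ⬝ᵥ a - ∑ i, ∑ j, T i j * C i j := by
  simp only [dotProduct]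
  rw [Finset.sum_comm, ← Finset.sum_sub_distrib]
  refine Finset.sum_congr rfl fun i _ => ?_
  rw [← hT i, Finset.mul_sum, ← Finset.sum_sub_distrib]
  exact Finset.sum_congr rfl fun j _ => by ring

theorem sum_col_dotProduct_add {m n : ℕ} {a : Fin m → ℝ} {b : Fin n → ℝ}
    {T : Matrix (Fin m) (Fin n) ℝ} (hT : T ∈ transportPolytope a b)
    (C : Matrix (Fin m) (Fin n) ℝ) (α : Fin m → ℝ) (β : Fin n → ℝ) :
    ∑ j, (fun i => α i + β j - C i j) ⬝ᵥ (fun i => T i j) =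
      α ⬝ᵥ a + β ⬝ᵥ b - ∑ i, ∑ j, T i j * C i j := by
  have h : ∀ j, (fun i => α i + β j - C i j) ⬝ᵥ (fun i => T i j) =
      (fun i => α i - C i j) ⬝ᵥ (fun i => T i j) + β j * b j := fun j => by
    rw [← hT.2.2 j, ← dotProduct_add_const]
    congr 1
    ext i
    ring
  rw [Finset.sum_congr rfl fun j _ => h j, Finset.sum_add_distrib, sum_col_dotProduct hT.2.1]
  simp only [dotProduct]
  ring

theorem semiDualVal_le_relaxedObj {m n k : ℕ} (hk : 1 ≤ k) (hkm : k ≤ m) {γ : ℝ} (hγ : 0 < γ)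
    {a : Fin m → ℝ} {b : Fin n → ℝ} {T : Matrix (Fin m) (Fin n) ℝ}
    (hT : T ∈ transportPolytope a b) (C : Matrix (Fin m) (Fin n) ℝ) (α : Fin m → ℝ) :
    semiDualVal k γ a b C α ≤ relaxedObj k γ C T := by
  have h := Finset.sum_le_sum fun j (_ : j ∈ Finset.univ) =>
    dotProduct_le_simplexConj_add hk hkm hγ (fun i => α i - C i j) (col_mem_scaledSimplex hT j)
  rw [sum_col_dotProduct hT.2.1, Finset.sum_add_distrib] at h
  unfold semiDualVal relaxedObj
  linarith

theorem sum_shift_orthantConj {m n : ℕ} (k : ℕ) (γ : ℝ) (b : Fin n → ℝ)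
    (C : Matrix (Fin m) (Fin n) ℝ) (α : Fin m → ℝ) (β : Fin n → ℝ) :
    ∑ j, (orthantConj m k γ (fun i => α i - C i j + β j) - β j * b j) =
      ∑ j, orthantConj m k γ (fun i => α i + β j - C i j) - β ⬝ᵥ b := by
  rw [Finset.sum_sub_distrib, dotProduct]
  simp only [sub_add_eq_add_sub]

theorem dualVal_le_semiDualVal {m n k : ℕ} (hk : 1 ≤ k) (hkm : k ≤ m) {γ : ℝ} (hγ : 0 < γ)
    (a : Fin m → ℝ) {b : Fin n → ℝ} (hb : ∀ j, 0 ≤ b j) (C : Matrix (Fin m) (Fin n) ℝ)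
    (α : Fin m → ℝ) (β : Fin n → ℝ) :
    dualVal k γ a b C α β ≤ semiDualVal k γ a b C α := by
  have h := Finset.sum_le_sum fun j (_ : j ∈ Finset.univ) =>
    simplexConj_le hk hkm hγ (hb j) (fun i => α i - C i j) (β j)
  rw [sum_shift_orthantConj] at h
  unfold dualVal semiDualVal
  linarith

theorem exists_dualVal_eq_semiDualVal {m n k : ℕ} (hk : 1 ≤ k) (hkm : k ≤ m) {γ : ℝ}
    (hγ : 0 < γ) (a : Fin m → ℝ) {b : Fin n → ℝ} (hb : ∀ j, 0 ≤ b j)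
    (C : Matrix (Fin m) (Fin n) ℝ) (α : Fin m → ℝ) :
    ∃ β : Fin n → ℝ, dualVal k γ a b C α β = semiDualVal k γ a b C α := by
  choose β hβ using fun j => exists_simplexConj_eq hk hkm hγ (hb j) (fun i => α i - C i j)
  refine ⟨β, ?_⟩
  have h := Finset.sum_congr rfl fun j (_ : j ∈ Finset.univ) => hβ j
  rw [sum_shift_orthantConj] at h
  unfold dualVal semiDualVal
  linarith

theorem continuous_relaxedObj {m n k : ℕ} (hk : 1 ≤ k) (hkm : k ≤ m) (γ : ℝ)
    (C : Matrix (Fin m) (Fin n) ℝ) : Continuous (relaxedObj k γ C) := by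
  have h := continuous_kSupport hk hkm
  unfold relaxedObj
  refine Continuous.add ?_ (continuous_finsetSum _ fun j _ => (h.comp ?_).const_mul γ)
  · fun_prop
  · fun_prop

theorem relaxedObj_eq_sum {m n : ℕ} (k : ℕ) (γ : ℝ) (C T : Matrix (Fin m) (Fin n) ℝ) :
    relaxedObj k γ C T =
      ∑ j, ((fun i => C i j) ⬝ᵥ (fun i => T i j) + γ * kSupport m k fun i => T i j) := by
  rw [relaxedObj, Finset.sum_comm, Finset.sum_add_distrib]
  simp only [dotProduct, mul_comm]

theorem convexOn_relaxedObj {m n k : ℕ} (hk : 1 ≤ k) (hkm : k ≤ m) {γ : ℝ} (hγ : 0 < γ)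
    (C : Matrix (Fin m) (Fin n) ℝ) : ConvexOn ℝ Set.univ (relaxedObj k γ C) := by
  refine ⟨convex_univ, fun x _ y _ u v hu hv huv => ?_⟩
  simp only [relaxedObj_eq_sum, smul_eq_mul, Finset.mul_sum]
  rw [← Finset.sum_add_distrib]
  refine Finset.sum_le_sum fun j _ => ?_
  have h := (convexOn_kSupport hk hkm).2 (Set.mem_univ fun i => x i j)
    (Set.mem_univ fun i => y i j) hu hv huv
  have hcol : (fun i => (u • x + v • y) i j) = u • (fun i => x i j) + v • fun i => y i j := rfl
  rw [hcol, dotProduct_add, dotProduct_smul, dotProduct_smul]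
  simp only [smul_eq_mul] at h ⊢
  nlinarith [mul_le_mul_of_nonneg_left h hγ.le]

theorem exists_relaxedObj_le_dualVal {m n k : ℕ} (hk : 1 ≤ k) (hkm : k ≤ m) {γ : ℝ} (hγ : 0 < γ)
    {a : Fin m → ℝ} {b : Fin n → ℝ} (C : Matrix (Fin m) (Fin n) ℝ)
    {T : Matrix (Fin m) (Fin n) ℝ} (hT : T ∈ transportPolytope a b)
    (hmin : ∀ T' ∈ transportPolytope a b, relaxedObj k γ C T ≤ relaxedObj k γ C T') :
    ∃ α β, relaxedObj k γ C T ≤ dualVal k γ a b C α β := by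
  obtain ⟨g, hg, hgmin⟩ := exists_subgradient_isMinOn (convexOn_relaxedObj hk hkm hγ C)
    (continuous_relaxedObj hk hkm γ C) (convex_transportPolytope a b) hT hmin
  obtain ⟨α, β, hle, hval⟩ := exists_potentials hT g hgmin
  refine ⟨α, β, ?_⟩
  have hcol : ∀ j, orthantConj m k γ (fun i => α i + β j - C i j) ≤
      (fun i => g (Matrix.single i j 1) - C i j) ⬝ᵥ (fun i => T i j)
        - γ * kSupport m k fun i => T i j := by
    intro j
    refine orthantConj_le_of_subgradient hk hkm hγ (fun t => ?_)
      fun i => sub_le_sub_right (hle i j) _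
    -- A j x is the defect of the subgradient inequality when column j is x. The objective is
    -- separable and A j vanishes at column j of T, so changing one column at a time splits the
    -- inequality.
    let A : Fin n → (Fin m → ℝ) → ℝ := fun j x =>
      ((fun i => C i j) ⬝ᵥ x + γ * kSupport m k x - (fun i => g (Matrix.single i j 1)) ⬝ᵥ x)
      - ((fun i => C i j) ⬝ᵥ (fun i => T i j) + γ * kSupport m k (fun i => T i j)
        - (fun i => g (Matrix.single i j 1)) ⬝ᵥ fun i => T i j)
    have hA : ∀ y : Matrix (Fin m) (Fin n) ℝ, 0 ≤ ∑ j, A j fun i => y i j := by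
      intro y
      have h := hg y
      rw [relaxedObj_eq_sum, relaxedObj_eq_sum, linearMap_apply_eq_sum_single g y,
        linearMap_apply_eq_sum_single g T] at h
      simp only [A, Finset.sum_sub_distrib, Finset.sum_add_distrib] at h ⊢
      linarith
    have h := hA (T.updateCol j t)
    rw [Finset.sum_eq_single j (fun j' _ hj' => by
        have : (fun i => T.updateCol j t i j') = fun i => T i j' := by
          ext i; rw [Matrix.updateCol_ne hj']
        simp only [this, A, sub_self]) (fun h => absurd (Finset.mem_univ j) h)] at h
    have hself : (fun i => T.updateCol j t i j) = t := by
      ext i; rw [Matrix.updateCol_self]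
    have hsub : ∀ x : Fin m → ℝ, (fun i => g (Matrix.single i j 1) - C i j) ⬝ᵥ x =
        (fun i => g (Matrix.single i j 1)) ⬝ᵥ x - (fun i => C i j) ⬝ᵥ x := fun x =>
      sub_dotProduct (fun i => g (Matrix.single i j 1)) (fun i => C i j) x
    simp only [hself, A] at h
    rw [hsub, hsub]
    linarith
  have h := Finset.sum_le_sum fun j (_ : j ∈ Finset.univ) => hcol j
  have hsub : ∀ j, (fun i => g (Matrix.single i j 1) - C i j) ⬝ᵥ (fun i => T i j) =
      (fun i => g (Matrix.single i j 1)) ⬝ᵥ (fun i => T i j)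
        - (fun i => C i j) ⬝ᵥ fun i => T i j := fun j =>
    sub_dotProduct (fun i => g (Matrix.single i j 1)) (fun i => C i j) _
  simp only [hsub, Finset.sum_sub_distrib] at h
  rw [← linearMap_apply_eq_sum_single g T, hval] at h
  rw [relaxedObj_eq_sum, dualVal, Finset.sum_add_distrib]
  linarith

/-- If dual variables without ties close the duality gap at `T`, the columns of `T` are sparse. -/
theorem col_mem_sparseSet_of_noTies {m n k : ℕ} (hk : 1 ≤ k) (hkm : k ≤ m) {γ : ℝ} (hγ : 0 < γ)
    {a : Fin m → ℝ} {b : Fin n → ℝ} {C T : Matrix (Fin m) (Fin n) ℝ}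
    (hT : T ∈ transportPolytope a b) {α : Fin m → ℝ} {β : Fin n → ℝ}
    (hgap : relaxedObj k γ C T ≤ dualVal k γ a b C α β)
    (hties : ∀ j, NoTies k (fun i => α i + β j - C i j)) (j : Fin n) :
    (fun i => T i j) ∈ sparseSet m k := by
  have hfy : ∀ j, (fun i => α i + β j - C i j) ⬝ᵥ (fun i => T i j) ≤
      orthantConj m k γ (fun i => α i + β j - C i j) + γ * kSupport m k fun i => T i j :=
    fun j => dotProduct_le_orthantConj_add hk hkm hγ _ (col_mem_scaledSimplex hT j).1
  refine mem_sparseSet_of_noTies hk hkm hγ (hties j) (col_mem_scaledSimplex hT j).1 ?_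
  -- Strict Fenchel-Young in one column would make the total gap strictly positive.
  by_contra! hlt
  have h := Finset.sum_lt_sum (fun j (_ : j ∈ Finset.univ) => hfy j) ⟨j, Finset.mem_univ j, hlt⟩
  rw [sum_col_dotProduct_add hT, Finset.sum_add_distrib] at h
  unfold relaxedObj dualVal at hgap
  linarith

/-! ### Extended real objectives -/

theorem primalObj_kSupport {m n k : ℕ} (hk : 1 ≤ k) (hkm : k ≤ m) (γ : ℝ)
    (C T : Matrix (Fin m) (Fin n) ℝ) :
    primalObj (fun t => (γ : EReal) * sqKSupport m k t) C T = (relaxedObj k γ C T : EReal) := by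
  simp only [primalObj, relaxedObj, EReal.coe_add, ereal_coe_sum, sqKSupport_eq_coe hk hkm,
    EReal.coe_mul]

theorem primalObj_sparseReg_of_sparse {m n k : ℕ} (γ : ℝ) (C : Matrix (Fin m) (Fin n) ℝ)
    {T : Matrix (Fin m) (Fin n) ℝ} (hT : ∀ j, (fun i => T i j) ∈ sparseSet m k) :
    primalObj (sparseReg m k γ) C T =
      (((∑ i, ∑ j, T i j * C i j) + ∑ j, γ / 2 * ∑ i, T i j ^ 2 : ℝ) : EReal) := by
  rw [primalObj, EReal.coe_add, ereal_coe_sum Finset.univ fun j => γ / 2 * ∑ i, T i j ^ 2,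
    Finset.sum_congr rfl fun j _ => sparseReg_of_mem γ (hT j)]

theorem primalObj_sparseReg_of_not_sparse {m n k : ℕ} (γ : ℝ) (C : Matrix (Fin m) (Fin n) ℝ)
    {T : Matrix (Fin m) (Fin n) ℝ} (hT : ¬ ∀ j, (fun i => T i j) ∈ sparseSet m k) :
    primalObj (sparseReg m k γ) C T = ⊤ := by
  push Not at hT
  obtain ⟨j, hj⟩ := hT
  rw [primalObj, ereal_sum_eq_top _ (fun j => sparseReg m k γ fun i => T i j) (fun j _ => sparseReg_ne_bot γ _)
    ⟨j, Finset.mem_univ j, sparseReg_of_notMem γ hj⟩]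
  exact EReal.coe_add_top _

theorem relaxedObj_le_primalObj {m n k : ℕ} (hk : 1 ≤ k) (hkm : k ≤ m) {γ : ℝ} (hγ : 0 < γ)
    (C T : Matrix (Fin m) (Fin n) ℝ) :
    (relaxedObj k γ C T : EReal) ≤ primalObj (sparseReg m k γ) C T := by
  by_cases hT : ∀ j, (fun i => T i j) ∈ sparseSet m k
  · rw [primalObj_sparseReg_of_sparse γ C hT]
    refine EReal.coe_le_coe_iff.2 (add_le_add_right (Finset.sum_le_sum fun j _ => ?_) _)
    have := mul_le_mul_of_nonneg_left (kSupport_le_half_sum_sq hk hkm (hT j)) hγ.le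
    linarith
  · rw [primalObj_sparseReg_of_not_sparse γ C hT]
    exact le_top

theorem primalObj_le_relaxedObj {m n k : ℕ} (hk : 1 ≤ k) (hkm : k ≤ m) {γ : ℝ} (hγ : 0 < γ)
    (C : Matrix (Fin m) (Fin n) ℝ) {T : Matrix (Fin m) (Fin n) ℝ}
    (hT : ∀ j, (fun i => T i j) ∈ sparseSet m k) :
    primalObj (sparseReg m k γ) C T ≤ (relaxedObj k γ C T : EReal) := by
  rw [primalObj_sparseReg_of_sparse γ C hT]
  refine EReal.coe_le_coe_iff.2 (add_le_add_right (Finset.sum_le_sum fun j _ => ?_) _)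
  have := mul_le_mul_of_nonneg_left (half_sum_sq_le_kSupport hk hkm fun i => T i j) hγ.le
  linarith

theorem dualObj_eq_coe {m n k : ℕ} (hk : 1 ≤ k) (hkm : k ≤ m) {γ : ℝ} (hγ : 0 < γ)
    (a : Fin m → ℝ) (b : Fin n → ℝ) (C : Matrix (Fin m) (Fin n) ℝ) (α : Fin m → ℝ)
    (β : Fin n → ℝ) :
    dualObj (sparseReg m k γ) a b C α β = (dualVal k γ a b C α β : EReal) := by
  simp only [dualObj, dualVal, conj_restrictOrthant_eq_coe hk hkm hγ, ← ereal_coe_sum,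
    ← EReal.coe_sub]

theorem semiDualObj_eq_coe {m n k : ℕ} (hk : 1 ≤ k) (hkm : k ≤ m) {γ : ℝ} (hγ : 0 < γ)
    (a : Fin m → ℝ) {b : Fin n → ℝ} (hb : ∀ j, 0 ≤ b j) (C : Matrix (Fin m) (Fin n) ℝ)
    (α : Fin m → ℝ) :
    semiDualObj (sparseReg m k γ) a b C α = (semiDualVal k γ a b C α : EReal) := by
  simp only [semiDualObj, semiDualVal, conj_restrictSimplex_eq_coe hk hkm hγ (hb _),
    ← ereal_coe_sum, ← EReal.coe_sub]

/-- The relaxed primal, the dual and the semi-dual problem have a common, attained value. -/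
theorem exists_optimal {m n k : ℕ} (hk : 1 ≤ k) (hkm : k ≤ m) {γ : ℝ} (hγ : 0 < γ)
    {a : Fin m → ℝ} {b : Fin n → ℝ} (C : Matrix (Fin m) (Fin n) ℝ)
    (ha : a ∈ stdSimplex ℝ (Fin m)) (hb : b ∈ stdSimplex ℝ (Fin n)) :
    ∃ T ∈ transportPolytope a b, ∃ α β,
      primal (fun t => (γ : EReal) * sqKSupport m k t) a b C = (relaxedObj k γ C T : EReal) ∧
      dual (sparseReg m k γ) a b C = (relaxedObj k γ C T : EReal) ∧
      semiDual (sparseReg m k γ) a b C = (relaxedObj k γ C T : EReal) ∧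
      dualVal k γ a b C α β = relaxedObj k γ C T ∧
      semiDualVal k γ a b C α = relaxedObj k γ C T := by
  obtain ⟨T, hT, hmin⟩ := (isCompact_transportPolytope a b).exists_isMinOn
    (transportPolytope_nonempty ha hb) (continuous_relaxedObj hk hkm γ C).continuousOn
  have hmin' : ∀ T' ∈ transportPolytope a b, relaxedObj k γ C T ≤ relaxedObj k γ C T' :=
    fun T' hT' => hmin hT'
  obtain ⟨α, β, hαβ⟩ := exists_relaxedObj_le_dualVal hk hkm hγ C hT hmin'
  have hDS := dualVal_le_semiDualVal hk hkm hγ a hb.1 C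
  have hSP := semiDualVal_le_relaxedObj hk hkm hγ hT C
  refine ⟨T, hT, α, β, ?_, ?_, ?_, ?_, ?_⟩
  · refine le_antisymm (iInf₂_le_of_le T hT (primalObj_kSupport hk hkm γ C T).le) ?_
    refine le_iInf₂ fun T' hT' => ?_
    rw [primalObj_kSupport hk hkm]
    exact EReal.coe_le_coe_iff.2 (hmin' T' hT')
  · refine le_antisymm (iSup₂_le fun α' β' => ?_) (le_iSup₂_of_le α β ?_)
    · rw [dualObj_eq_coe hk hkm hγ]
      exact EReal.coe_le_coe_iff.2 ((hDS α' β').trans (hSP α'))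
    · rw [dualObj_eq_coe hk hkm hγ]
      exact EReal.coe_le_coe_iff.2 hαβ
  · refine le_antisymm (iSup_le fun α' => ?_) (le_iSup_of_le α ?_)
    · rw [semiDualObj_eq_coe hk hkm hγ a hb.1]
      exact EReal.coe_le_coe_iff.2 (hSP α')
    · rw [semiDualObj_eq_coe hk hkm hγ a hb.1]
      exact EReal.coe_le_coe_iff.2 (hαβ.trans (hDS α β))
  · exact le_antisymm ((hDS α β).trans (hSP α)) hαβ
  · exact le_antisymm (hSP α) (hαβ.trans (hDS α β))

theorem isClosed_sparseSet (m k : ℕ) : IsClosed (sparseSet m k) := by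
  have h : sparseSet m k = ⋃ I ∈ {I : Finset (Fin m) | I.card ≤ k},
      {t : Fin m → ℝ | ∀ i ∉ I, t i = 0} := by
    ext t
    simp only [Set.mem_iUnion, Set.mem_ofPred_eq, exists_prop]
    refine ⟨fun ht => ⟨Finset.univ.filter fun i => t i ≠ 0, ht, fun i hi => by simpa using hi⟩,
      fun ⟨I, hI, ht⟩ => mem_sparseSet_of_support_subset hI ht⟩
  rw [h]
  refine Set.Finite.isClosed_biUnion (Set.toFinite _) fun I _ => ?_
  simp only [Set.ofPred_forall]
  exact isClosed_iInter fun i => isClosed_iInter fun _ =>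
    isClosed_eq (continuous_apply i) continuous_const

/-- The minimum in the sparsity-constrained primal problem is attained. -/
theorem exists_primalObj_sparseReg_eq {m n : ℕ} (k : ℕ) (γ : ℝ) {a : Fin m → ℝ} {b : Fin n → ℝ}
    (C : Matrix (Fin m) (Fin n) ℝ) (hne : (transportPolytope a b).Nonempty) :
    ∃ T ∈ transportPolytope a b,
      primalObj (sparseReg m k γ) C T = primal (sparseReg m k γ) a b C := by
  let K : Set (Matrix (Fin m) (Fin n) ℝ) :=
    transportPolytope a b ∩ {T | ∀ j, (fun i => T i j) ∈ sparseSet m k}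
  have hKc : IsCompact K := by
    refine (isCompact_transportPolytope a b).inter_right ?_
    simp only [Set.ofPred_forall]
    refine isClosed_iInter fun j => (isClosed_sparseSet m k).preimage ?_
    fun_prop
  have hle : ∀ T ∈ transportPolytope a b,
      (∀ T' ∈ transportPolytope a b,
        primalObj (sparseReg m k γ) C T ≤ primalObj (sparseReg m k γ) C T') →
      primalObj (sparseReg m k γ) C T = primal (sparseReg m k γ) a b C := fun T hT h =>
    le_antisymm (le_iInf₂ h) (iInf₂_le T hT)
  -- Without a sparse plan every value is ⊤, and any plan attains it.
  rcases K.eq_empty_or_nonempty with hK | hK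
  · obtain ⟨T, hT⟩ := hne
    refine ⟨T, hT, hle T hT fun T' hT' => ?_⟩
    rw [primalObj_sparseReg_of_not_sparse γ C (T := T')
      fun hc => Set.notMem_empty T' (hK ▸ ⟨hT', hc⟩)]
    exact le_top
  · obtain ⟨T, hT, hmin⟩ := hKc.exists_isMinOn hK
      (f := fun T => (∑ i, ∑ j, T i j * C i j) + ∑ j, γ / 2 * ∑ i, T i j ^ 2)
      (Continuous.continuousOn (by fun_prop))
    refine ⟨T, hT.1, hle T hT.1 fun T' hT' => ?_⟩
    by_cases hs : ∀ j, (fun i => T' i j) ∈ sparseSet m k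
    · rw [primalObj_sparseReg_of_sparse γ C hT.2, primalObj_sparseReg_of_sparse γ C hs]
      exact EReal.coe_le_coe_iff.2 (hmin ⟨hT', hs⟩)
    · rw [primalObj_sparseReg_of_not_sparse γ C hs]
      exact le_top

/-- The conjugate of the primal value in its first marginal. -/
theorem conj_primal {m n k : ℕ} (hk : 1 ≤ k) (hkm : k ≤ m) {γ : ℝ} (hγ : 0 < γ) {b : Fin n → ℝ}
    (hb : ∀ j, 0 ≤ b j) (C : Matrix (Fin m) (Fin n) ℝ) (α : Fin m → ℝ) :
    conj (fun a' => primal (sparseReg m k γ) a' b C) α =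
      ∑ j, conj (restrictSimplex (sparseReg m k γ) (b j)) (fun i => α i - C i j) := by
  rw [Finset.sum_congr rfl fun j _ => conj_restrictSimplex_eq_coe hk hkm hγ (hb j) _,
    ← ereal_coe_sum]
  refine le_antisymm (iSup_le fun a' => ?_) ?_
  -- The primal value is moved to the right-hand side, so that it suffices to bound the objective of
  -- each plan below.
  · rw [EReal.sub_le_iff_le_add (Or.inr (EReal.coe_ne_top _)) (Or.inr (EReal.coe_ne_bot _)),
      add_comm, ← EReal.sub_le_iff_le_add (Or.inl (EReal.coe_ne_bot _))
        (Or.inl (EReal.coe_ne_top _)), ← EReal.coe_sub]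
    refine le_iInf₂ fun T hT => ?_
    by_cases hs : ∀ j, (fun i => T i j) ∈ sparseSet m k
    · rw [primalObj_sparseReg_of_sparse γ C hs]
      refine EReal.coe_le_coe_iff.2 ?_
      have h := Finset.sum_le_sum fun j (_ : j ∈ Finset.univ) =>
        dotProduct_sub_le_simplexConj hk hkm hγ (fun i => α i - C i j)
          ⟨hs j, col_mem_scaledSimplex hT j⟩
      rw [Finset.sum_sub_distrib, sum_col_dotProduct hT.2.1] at h
      linarith
    · rw [primalObj_sparseReg_of_not_sparse γ C hs]
      exact le_top
  -- The first marginal is free, so the columns decouple: the maximizers of the column problems form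
  -- T, and a' is its vector of row sums.
  · choose t ht htv using fun j =>
      exists_dotProduct_sub_eq_simplexConj hk hkm hγ (hb j) (fun i => α i - C i j)
    let T : Matrix (Fin m) (Fin n) ℝ := Matrix.of fun i j => t j i
    let a' : Fin m → ℝ := fun i => ∑ j, T i j
    have hT : T ∈ transportPolytope a' b :=
      ⟨fun i j => (ht j).2.1 i, fun i => rfl, fun j => (ht j).2.2⟩
    have hs : ∀ j, (fun i => T i j) ∈ sparseSet m k := fun j => (ht j).1
    have hval : ∑ j, simplexConj m k γ (b j) (fun i => α i - C i j) =
        α ⬝ᵥ a' - ((∑ i, ∑ j, T i j * C i j) + ∑ j, γ / 2 * ∑ i, T i j ^ 2) := by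
      rw [← sub_sub, ← sum_col_dotProduct hT.2.1, ← Finset.sum_sub_distrib]
      exact Finset.sum_congr rfl fun j _ => (htv j).symm
    calc ((∑ j, simplexConj m k γ (b j) (fun i => α i - C i j) : ℝ) : EReal)
        = ((α ⬝ᵥ a' : ℝ) : EReal) - primalObj (sparseReg m k γ) C T := by
          rw [hval, EReal.coe_sub, primalObj_sparseReg_of_sparse γ C hs]
      _ ≤ ((α ⬝ᵥ a' : ℝ) : EReal) - primal (sparseReg m k γ) a' b C :=
          EReal.sub_le_sub le_rfl (iInf₂_le T hT)
      _ ≤ _ := le_conj (fun a' => primal (sparseReg m k γ) a' b C) α a'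

end SparseOT

open SparseOT

theorem proposition3 (m k : ℕ) (hk : 1 ≤ k) (hkm : k ≤ m) (γ : ℝ) (hγ : 0 < γ)
    (Ω Ψ : (Fin m → ℝ) → EReal)
    (hΩ : Ω = SparseOT.sparseReg m k γ)
    (hΨ : Ψ = fun t => (γ : EReal) * SparseOT.sqKSupport m k t) :
    -- the biconjugate over the nonnegative orthant
    (∀ t : Fin m → ℝ,
      (t ∈ SparseOT.orthant m →
        SparseOT.conj (SparseOT.conj (SparseOT.restrictOrthant Ω)) t = Ψ t) ∧
      (t ∉ SparseOT.orthant m →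
        SparseOT.conj (SparseOT.conj (SparseOT.restrictOrthant Ω)) t = ⊤)) ∧
    -- the biconjugate over the scaled simplex
    (∀ b : ℝ, 0 ≤ b → ∀ t : Fin m → ℝ,
      (t ∈ SparseOT.scaledSimplex m b →
        SparseOT.conj (SparseOT.conj (SparseOT.restrictSimplex Ω b)) t = Ψ t) ∧
      (t ∉ SparseOT.scaledSimplex m b →
        SparseOT.conj (SparseOT.conj (SparseOT.restrictSimplex Ω b)) t = ⊤)) ∧
    ∀ (n : ℕ) (a : Fin m → ℝ) (b : Fin n → ℝ) (C : Matrix (Fin m) (Fin n) ℝ),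
      a ∈ stdSimplex ℝ (Fin m) → b ∈ stdSimplex ℝ (Fin n) → (∀ i j, 0 ≤ C i j) →
      -- the optimal values
      SparseOT.dual Ω a b C = SparseOT.semiDual Ω a b C ∧
      SparseOT.semiDual Ω a b C = SparseOT.primal Ψ a b C ∧
      SparseOT.primal Ψ a b C ≤ SparseOT.primal Ω a b C ∧
      -- all four of them are attained
      (∃ α β, SparseOT.dualObj Ω a b C α β = SparseOT.dual Ω a b C) ∧
      (∃ α, SparseOT.semiDualObj Ω a b C α = SparseOT.semiDual Ω a b C) ∧
      (∃ T ∈ SparseOT.transportPolytope a b,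
        SparseOT.primalObj Ψ C T = SparseOT.primal Ψ a b C) ∧
      (∃ T ∈ SparseOT.transportPolytope a b,
        SparseOT.primalObj Ω C T = SparseOT.primal Ω a b C) ∧
      -- the sum in the semi-dual is the conjugate of the primal value in its first argument
      (∀ α : Fin m → ℝ,
        SparseOT.conj (fun a' => SparseOT.primal Ω a' b C) α =
          ∑ j, SparseOT.conj (SparseOT.restrictSimplex Ω (b j)) (fun i => α i - C i j)) ∧
      -- equality when an optimal dual or semi-dual solution has no ties
      (∀ α β, SparseOT.dualObj Ω a b C α β = SparseOT.dual Ω a b C →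
        (∀ j, SparseOT.NoTies k (fun i => α i + β j - C i j)) →
        SparseOT.primal Ψ a b C = SparseOT.primal Ω a b C) ∧
      (∀ α, SparseOT.semiDualObj Ω a b C α = SparseOT.semiDual Ω a b C →
        (∀ j, SparseOT.NoTies k (fun i => α i - C i j)) →
        SparseOT.primal Ψ a b C = SparseOT.primal Ω a b C) := by
  subst hΩ hΨ
  have hΨ : ∀ t, (γ : EReal) * sqKSupport m k t = ((γ * kSupport m k t : ℝ) : EReal) := fun t => by
    rw [sqKSupport_eq_coe hk hkm, EReal.coe_mul]
  refine ⟨fun t => ⟨fun ht => ?_, conj_conj_restrictOrthant_eq_top hγ⟩,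
    fun b _ t => ⟨fun ht => ?_, conj_conj_restrictSimplex_eq_top hγ⟩, fun n a b C ha hb _ => ?_⟩
  · exact (conj_conj_restrictOrthant hk hkm hγ ht).trans (hΨ t).symm
  · exact (conj_conj_restrictSimplex hk hkm hγ ht).trans (hΨ t).symm
  obtain ⟨T, hT, α, β, hP, hD, hS, hDv, hSv⟩ := exists_optimal hk hkm hγ C ha hb
  have hle : primal (fun t => (γ : EReal) * sqKSupport m k t) a b C ≤
      primal (sparseReg m k γ) a b C :=
    iInf₂_mono fun T _ => (primalObj_kSupport hk hkm γ C T).le.trans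
      (relaxedObj_le_primalObj hk hkm hγ C T)
  have hties : ∀ α β, relaxedObj k γ C T ≤ dualVal k γ a b C α β →
      (∀ j, NoTies k (fun i => α i + β j - C i j)) →
      primal (fun t => (γ : EReal) * sqKSupport m k t) a b C =
        primal (sparseReg m k γ) a b C := by
    intro α β hgap hno
    refine le_antisymm hle ?_
    rw [hP]
    exact iInf₂_le_of_le T hT (primalObj_le_relaxedObj hk hkm hγ C
      (col_mem_sparseSet_of_noTies hk hkm hγ hT hgap hno))
  refine ⟨hD.trans hS.symm, hS.trans hP.symm, hle, ⟨α, β, ?_⟩, ⟨α, ?_⟩, ⟨T, hT, ?_⟩,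
    exists_primalObj_sparseReg_eq k γ C (transportPolytope_nonempty ha hb),
    conj_primal hk hkm hγ hb.1 C, fun α β hopt hno => ?_, fun α hopt hno => ?_⟩
  · rw [dualObj_eq_coe hk hkm hγ, hDv, hD]
  · rw [semiDualObj_eq_coe hk hkm hγ a hb.1, hSv, hS]
  · rw [primalObj_kSupport hk hkm, hP]
  · rw [dualObj_eq_coe hk hkm hγ, hD] at hopt
    exact hties α β (EReal.coe_eq_coe_iff.1 hopt).ge hno
  · rw [semiDualObj_eq_coe hk hkm hγ a hb.1, hS] at hopt
    -- Optimal shifts β complete α to a dual solution of the same value, and adding a constant to a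
    -- column creates no ties.
    obtain ⟨β, hβ⟩ := exists_dualVal_eq_semiDualVal hk hkm hγ a hb.1 C α
    refine hties α β (by rw [hβ]; exact (EReal.coe_eq_coe_iff.1 hopt).ge) fun j => ?_
    simpa only [sub_add_eq_add_sub] using (hno j).add_const (β j)
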